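/- Let $0<R\le 1$. Let $S^2_R\subset S^2\subset\mathbb R^3$ be the spherical cap $S^2_R=\Psi(B_R(0))=\{X\in S^2:\ X_3>\sigma\}$, where $\Psi\colon\mathbb R^2\to S^2$ is inverse stereographic projection with $\Psi(0)=(0,0,1)$, and where $\sigma=\frac{1-R^2}{1+R^2}$. Let $\nu$ be the outer unit normal of $S^2_R$ along $\partial S^2_R$, let $k_R=\frac{1-R^2}{2R}\ge 0$ be the geodesic curvature of $\partial S^2_R$, and let $\hat\mu_R$ be the measure on $\overline{S^2_R}$ with $$\int\varphi\,d\hat\mu_R=2\int_{S^2_R}\varphi\,d\mu_{g_{S^2}}+k_R\int_{\partial S^2_R}\varphi\,ds_{g_{S^2}}.$$ A function $\varphi\not\equiv 0$ is a Steklov eigenfunction with eigenvalue $\lambda$ if $$-\Delta_{g_{S^2}}\varphi=2\lambda\varphi\ \text{ in } S^2_R,\qquad \frac{\partial\varphi}{\partial\nu}=\lambda k_R\varphi\ \text{ on }\partial S^2_R;$$ it is a weak Steklov eigenfunction if $0\ne\varphi\in H^1(S^2_R)$ and $\int_{S^2_R}\nabla\varphi\cdot\nabla\psi\,d\mu_{g_{S^2}}=\lambda\int\varphi\psi\,d\hat\mu_R$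 for all $\psi\in H^1(S^2_R)$. For $i\in\mathbb N_0$ let $$\lambda_i=\inf_{X\subset H^1(S^2_R),\ \dim X\ge i+1}\ \sup_{v\in X\setminus\{0\}}\frac{\|\nabla v\|^2_{L^2(S^2_R)}}{\|v\|^2_{L^2(\hat\mu_R)}},$$ where $X$ ranges over linear subspaces. Then the coordinate functions $X_1,X_2$ are Steklov eigenfunctions with eigenvalue $1$, both classically and weakly; $\lambda_1=\lambda_2=1$; and $\lambda_i>1$ for every $i\ge 3$. Likewise, if $(\varphi_i)_{i\in\mathbb N_0}$ is any complete orthonormal system of $L^2(\hat\mu_R)$ consisting of weak Steklov eigenfunctions whose eigenvalues $\lambda_0'\le\lambda_1'\le\lambda_2'\le\dots$ are in nondecreasing order, then $\lambda_1'=\lambda_2'=1$ and $\lambda_i'>1$ for every $i\ge 3$. -/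

import Mathlib

open MeasureTheory
open scoped ENNReal ContDiff

namespace SteklovCap

/-! ### The spherical cap -/

/-- The Euclidean plane. -/
abbrev E2 := EuclideanSpace ℝ (Fin 2)

/-- Euclidean space `ℝ³`; the coordinates `X₁, X₂, X₃` are `x 0, x 1, x 2`. -/
abbrev E3 := EuclideanSpace ℝ (Fin 3)

/-- The inverse `Ψ : ℝ² → S²` of stereographic projection, with `Ψ 0` the north pole `(0,0,1)`. -/
noncomputable def stereoInv (y : E2) : E3 :=
  !₂[2 * y 0 / (1 + ‖y‖ ^ 2), 2 * y 1 / (1 + ‖y‖ ^ 2), (1 - ‖y‖ ^ 2) / (1 + ‖y‖ ^ 2)]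

/-- The spherical cap `S²_R = Ψ_R(B)`, where `Ψ_R z = Ψ (R z)` and `B` is the open unit disc. -/
noncomputable def cap (R : ℝ) : Set E3 :=
  (fun z : E2 => stereoInv (R • z)) '' Metric.ball 0 1

/-- The boundary circle `∂S²_R = Ψ_R(∂B)`. -/
noncomputable def capBoundary (R : ℝ) : Set E3 :=
  (fun z : E2 => stereoInv (R • z)) '' Metric.sphere 0 1

/-- The constant value `r = 2R / (1 + R²)` of `|(X₁, X₂)|` on the boundary circle. -/
noncomputable def capRadius (R : ℝ) : ℝ := 2 * R / (1 + R ^ 2)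

/-- The constant value `σ = (1 - R²) / (1 + R²)` of `X₃` on the boundary circle. -/
noncomputable def capHeight (R : ℝ) : ℝ := (1 - R ^ 2) / (1 + R ^ 2)

/-- The geodesic curvature `k_R = (1 - R²) / (2R)` of the boundary circle. -/
noncomputable def boundaryCurvature (R : ℝ) : ℝ := (1 - R ^ 2) / (2 * R)

/-- The outer unit normal `(σ z, -r)`, `z = (X₁, X₂) / r`, of the cap along its boundary. -/
noncomputable def outerNormal (R : ℝ) (x : E3) : E3 :=
  !₂[capHeight R * (x 0 / capRadius R), capHeight R * (x 1 / capRadius R), -capRadius R]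

/-! ### Measures -/

/-- The area measure `μ_{g_{S²}}` of the cap, as a measure on `ℝ³`. -/
noncomputable def areaMeasure (R : ℝ) : Measure E3 :=
  ((volume : Measure E3).toSphere.map Subtype.val).restrict (cap R)

/-- The parametrization of the boundary circle by the angle. -/
noncomputable def boundaryCurve (R : ℝ) (t : ℝ) : E3 :=
  !₂[capRadius R * Real.cos t, capRadius R * Real.sin t, capHeight R]

/-- The arc length measure `ds_{g_{S²}}` of the boundary circle (radius `r`), as a measure
on `ℝ³`. -/
noncomputable def arcMeasure (R : ℝ) : Measure E3 :=
  ENNReal.ofReal (capRadius R) •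
    (volume.restrict (Set.Ioc 0 (2 * Real.pi))).map (boundaryCurve R)

/-- The measure `μ̂_R` on the closed cap,
`∫ φ dμ̂_R = 2 ∫_{S²_R} φ dμ + k_R ∫_{∂S²_R} φ ds`. -/
noncomputable def hatMeasure (R : ℝ) : Measure E3 :=
  (2 : ℝ≥0∞) • areaMeasure R + ENNReal.ofReal (boundaryCurvature R) • arcMeasure R

/-! ### Differential operators and classical Steklov eigenfunctions -/

/-- The gradient on the unit sphere of (the restriction of) `φ`: the component of the ambient
gradient tangent to the sphere at `x`. -/
noncomputable def sphereGrad (φ : E3 → ℝ) (x : E3) : E3 :=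
  gradient φ x - inner ℝ (gradient φ x) x • x

/-- The Laplace-Beltrami operator of the unit sphere applied to (the restriction of) `φ`,
at a point `x` of the sphere: the Laplacian of the extension of `φ` that is constant along rays. -/
noncomputable def sphereLaplacian (φ : E3 → ℝ) (x : E3) : ℝ :=
  Laplacian.laplacian (fun y : E3 => φ (‖y‖⁻¹ • y)) x

/-- Classical Steklov eigenfunctions with eigenvalue `lam`: nontrivial functions on the cap,
smooth up to the boundary, with `-Δφ = 2 lam φ` in `S²_R` and `∂φ/∂ν = lam k_R φ` on `∂S²_R`. -/
structure IsSteklovEigenfunction (R lam : ℝ) (φ : E3 → ℝ) : Prop where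
  smooth : ContDiff ℝ ∞ φ
  nontrivial : ∃ x ∈ cap R, φ x ≠ 0
  interior : ∀ x ∈ cap R, -sphereLaplacian φ x = 2 * lam * φ x
  boundary : ∀ x ∈ capBoundary R,
    inner ℝ (sphereGrad φ x) (outerNormal R x) = lam * boundaryCurvature R * φ x

/-! ### The Sobolev space `H¹(S²_R)` -/

/-- Smooth functions on `ℝ³`; their restrictions are the functions on the cap that are smooth up
to the boundary. -/
def smoothFun : Submodule ℝ (E3 → ℝ) where
  carrier := {φ | ContDiff ℝ ∞ φ}
  add_mem' {f g} (hf : ContDiff ℝ ∞ f) (hg : ContDiff ℝ ∞ g) := hf.add hg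
  zero_mem' := (contDiff_const : ContDiff ℝ ∞ fun _ : E3 => (0 : ℝ))
  smul_mem' _ f (hf : ContDiff ℝ ∞ f) := contDiff_const.smul hf

theorem smoothFun.contDiff (φ : smoothFun) : ContDiff ℝ ∞ φ.1 := φ.2

theorem norm_boundaryCurve (R t : ℝ) : ‖boundaryCurve R t‖ = 1 := by
  have h : (1 + R ^ 2) ≠ 0 := by positivity
  rw [EuclideanSpace.norm_eq, Real.sqrt_eq_one]
  simp only [boundaryCurve, Fin.sum_univ_three, Real.norm_eq_abs, sq_abs]
  simp only [capRadius, capHeight, Matrix.cons_val]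
  have hcs := Real.sin_sq_add_cos_sq t
  field_simp
  linear_combination (4 * R ^ 2) * hcs

theorem measurable_boundaryCurve (R : ℝ) : Measurable (boundaryCurve R) := by
  apply Continuous.measurable
  unfold boundaryCurve
  fun_prop

instance (R : ℝ) : IsFiniteMeasure (areaMeasure R) := by
  unfold areaMeasure; infer_instance

instance (R : ℝ) : IsFiniteMeasure (arcMeasure R) := by
  unfold arcMeasure
  exact Measure.smul_finite _ ENNReal.ofReal_ne_top

instance (R : ℝ) : IsFiniteMeasure (hatMeasure R) := by
  have := Measure.smul_finite (areaMeasure R) (c := 2) (by simp)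
  have := Measure.smul_finite (arcMeasure R) (c := ENNReal.ofReal (boundaryCurvature R))
    ENNReal.ofReal_ne_top
  unfold hatMeasure; infer_instance

theorem ae_norm_areaMeasure (R : ℝ) : ∀ᵐ x ∂(areaMeasure R), ‖x‖ = 1 := by
  apply ae_restrict_of_ae
  rw [ae_map_iff measurable_subtype_coe.aemeasurable
    (measurableSet_eq_fun measurable_norm measurable_const)]
  exact Filter.Eventually.of_forall fun x => by simp

theorem ae_norm_arcMeasure (R : ℝ) : ∀ᵐ x ∂(arcMeasure R), ‖x‖ = 1 := by
  apply Measure.ae_smul_measure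
  rw [ae_map_iff (measurable_boundaryCurve R).aemeasurable
    (measurableSet_eq_fun measurable_norm measurable_const)]
  exact Filter.Eventually.of_forall fun x => norm_boundaryCurve R x

theorem ae_norm_hatMeasure (R : ℝ) : ∀ᵐ x ∂(hatMeasure R), ‖x‖ = 1 := by
  rw [hatMeasure, ae_add_measure_iff]
  exact ⟨Measure.ae_smul_measure (ae_norm_areaMeasure R) _,
    Measure.ae_smul_measure (ae_norm_arcMeasure R) _⟩

theorem memLp_of_continuous {F : Type*} [NormedAddCommGroup F] {μ : Measure E3}
    [IsFiniteMeasure μ] (hμ : ∀ᵐ x ∂μ, ‖x‖ = 1) {f : E3 → F} (hf : Continuous f) :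
    MemLp f 2 μ := by
  obtain ⟨C, hC⟩ := (isCompact_sphere (0 : E3) 1).exists_bound_of_continuousOn hf.continuousOn
  have hs : AEStronglyMeasurable f μ := hf.aestronglyMeasurable
  exact MemLp.of_bound hs C (hμ.mono fun x hx => hC x (by simpa using hx))

theorem continuous_sphereGrad {φ : E3 → ℝ} (hφ : ContDiff ℝ ∞ φ) :
    Continuous (sphereGrad φ) := by
  have h : Continuous (gradient φ) := by
    unfold gradient
    exact (LinearIsometryEquiv.continuous _).comp (hφ.continuous_fderiv (by simp))
  unfold sphereGrad
  fun_prop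

/-- The space `L²(S²_R, μ̂_R)`. -/
noncomputable abbrev L2hat (R : ℝ) := Lp ℝ 2 (hatMeasure R)

/-- The space of square integrable `ℝ³`-valued fields on the cap, where gradients live. -/
noncomputable abbrev L2grad (R : ℝ) := Lp E3 2 (areaMeasure R)

/-- The map `φ ↦ (φ, ∇φ)` on functions that are smooth up to the boundary of the cap. -/
noncomputable def smoothGraph (R : ℝ) : smoothFun →ₗ[ℝ] L2hat R × L2grad R where
  toFun φ :=
    ((memLp_of_continuous (ae_norm_hatMeasure R) (smoothFun.contDiff φ).continuous).toLp φ.1,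
      (memLp_of_continuous (ae_norm_areaMeasure R) (continuous_sphereGrad (smoothFun.contDiff φ))).toLp
        (sphereGrad φ.1))
  map_add' φ ψ := by
    have h : sphereGrad (φ.1 + ψ.1) = sphereGrad φ.1 + sphereGrad ψ.1 := by
      funext x
      have h1 := ((smoothFun.contDiff φ).differentiable (by simp)).differentiableAt (x := x)
      have h2 := ((smoothFun.contDiff ψ).differentiable (by simp)).differentiableAt (x := x)
      simp only [sphereGrad, gradient, fderiv_add h1 h2, map_add, inner_add_left, Pi.add_apply]
      module
    refine Prod.ext rfl ?_
    simp only [Submodule.coe_add, h, Prod.snd_add]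
    rfl
  map_smul' c φ := by
    have h : sphereGrad (c • φ.1) = c • sphereGrad φ.1 := by
      funext x
      have h1 := ((smoothFun.contDiff φ).differentiable (by simp)).differentiableAt (x := x)
      simp only [sphereGrad, gradient, fderiv_const_smul h1, map_smul, Pi.smul_apply,
        inner_smul_left]
      simp [smul_sub, smul_smul]
    refine Prod.ext rfl ?_
    simp only [Submodule.coe_smul, h, Prod.smul_snd, RingHom.id_apply]
    rfl

/-- The Sobolev space `H¹(S²_R)`, as the completion of the functions smooth up to the boundary.
An element is a pair `(v, ∇v)`, where `v ∈ L²(S²_R, μ̂_R)` comprises the function on the cap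
and (where `k_R > 0`) its trace on the boundary circle, and `∇v ∈ L²(S²_R)` is its weak gradient.
By the trace inequality, convergence of `(v, ∇v)` in `L²(μ̂_R) × L²` is the same as convergence
in the `H¹` norm, so that this closure is the usual space. -/
noncomputable def H1 (R : ℝ) : Submodule ℝ (L2hat R × L2grad R) :=
  (LinearMap.range (smoothGraph R)).topologicalClosure

/-- The element of `L²(S²_R, μ̂_R)` underlying an element of `H¹(S²_R)`. -/
noncomputable def toL2 {R : ℝ} (v : H1 R) : L2hat R := (v : L2hat R × L2grad R).1

/-- The weak gradient of an element of `H¹(S²_R)`. -/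
noncomputable def weakGrad {R : ℝ} (v : H1 R) : L2grad R := (v : L2hat R × L2grad R).2

/-- The class in `H¹(S²_R)` of a function that is smooth up to the boundary. -/
noncomputable def ofSmooth (R : ℝ) (φ : E3 → ℝ) (hφ : ContDiff ℝ ∞ φ) : H1 R :=
  ⟨smoothGraph R ⟨φ, hφ⟩, Submodule.le_topologicalClosure _ (LinearMap.mem_range_self _ _)⟩

/-! ### Steklov eigenvalues -/

/-- Steklov eigenfunctions in `H¹(S²_R)`, that is, nontrivial weak solutions of
`-Δφ = 2 lam φ` in `S²_R`, `∂φ/∂ν = lam k_R φ` on `∂S²_R`: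
`∫ ∇φ · ∇ψ dμ = lam (2 ∫ φ ψ dμ + k_R ∫_∂ φ ψ ds)` for all `ψ ∈ H¹(S²_R)`. -/
structure IsWeakSteklovEigenfunction (R lam : ℝ) (φ : H1 R) : Prop where
  nontrivial : φ ≠ 0
  weak : ∀ ψ : H1 R, inner ℝ (weakGrad φ) (weakGrad ψ) = lam * inner ℝ (toL2 φ) (toL2 ψ)

/-- A nondecreasing sequence of eigenvalues `lam i` (repeated according to multiplicity) together
with Steklov eigenfunctions `φ i`, `i ∈ ℕ`, that form a complete orthonormal system of
`L²(S²_R, μ̂_R)`. -/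
structure IsSteklovSystem (R : ℝ) (lam : ℕ → ℝ) (φ : ℕ → H1 R) : Prop where
  eigen : ∀ i, IsWeakSteklovEigenfunction R (lam i) (φ i)
  mono : Monotone lam
  orthonormal : Orthonormal ℝ (fun i => toL2 (φ i))
  complete : (Submodule.span ℝ (Set.range fun i => toL2 (φ i))).topologicalClosure = ⊤

/-- The `i`-th Steklov eigenvalue, `i ∈ ℕ`, given by the min-max principle: the infimum over the
linear subspaces `X ⊆ H¹(S²_R)` of dimension at least `i + 1` of the supremum over `v ∈ X \ {0}` of
`‖∇v‖²_{L²(S²_R)} / ‖v‖²_{L²(S²_R, μ̂_R)}`. -/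
noncomputable def steklovEigenvalue (R : ℝ) (i : ℕ) : ℝ≥0∞ :=
  ⨅ (X : Submodule ℝ (H1 R)) (_ : ((i + 1 : ℕ) : Cardinal) ≤ Module.rank ℝ X),
    ⨆ (v : H1 R) (_ : v ∈ X) (_ : v ≠ 0), ‖weakGrad v‖ₑ ^ 2 / ‖toL2 v‖ₑ ^ 2

/-- The ambient coordinate function `X_{i+1}`, `i = 0, 1, 2`. -/
def coord (i : Fin 3) (x : E3) : ℝ := x i

theorem contDiff_coord (i : Fin 3) : ContDiff ℝ ∞ (coord i) := by
  unfold coord; fun_prop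

end SteklovCap

namespace SteklovCap

open Real

/-! In polar coordinates `(ρ, θ)` about the north pole the cap is `ρ < A` with `A = capAngle R ≤ π /
2`, and `k_R` times the boundary radius equals `cos A`. Hence `∫ g dμ̂ = 2 ∫₀ᴬ sin ρ ∫ g dθ dρ + cos
A ∫ g(A, θ) dθ` (`integral_hatMeasure`), and only `A` matters.

The functions `1, X₁, X₂` are weak eigenfunctions with eigenvalues `0, 1, 1`, by integration by
parts (`IsPolarSmooth.weak_mode_one`). Everything else follows from a quantitative gap: the
Dirichlet energy is at least `11/10` times the squared `L²(μ̂)` norm on functions orthogonal to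
these three (`IsPolarSmooth.gap`). The constant does not depend on `R`.

The gap is proved by Fourier decomposition in `θ`. The mean mode is handled by Picone's inequality
with explicit polynomial comparison functions (`mode_zero_gap`). In the modes of order one the
comparison function `sin ρ` gives exactly the ratio `1`, and a correction term using the
orthogonality condition improves it to `9/8` (`mode_one_gap`). All modes of order at least two are
treated together: Wirtinger's inequality supplies a factor `4` for the angular energy, and the
comparison function `sin² ρ` does the rest (`mode_high_le`).

Density of smooth functions carries the gap to `H¹` (`gap_highMode`). Since the splitting into low
and high part is orthogonal for both quadratic forms, the min-max values follow from dimension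
counting. For a complete system, an eigenvalue other than `0` and `1` is at least `11/10`, and the
eigenspaces of `0` and `1` are spanned by `1` and by `X₁, X₂`. -/

/-! ### Fourier modes of order zero and one on the circle -/

/-- The mean value of a function on the circle. -/
noncomputable def meanMode (g : ℝ → ℝ) : ℝ := (2 * π)⁻¹ * ∫ θ in 0..2 * π, g θ

/-- The Fourier coefficient of `cos`. -/
noncomputable def cosMode (g : ℝ → ℝ) : ℝ := π⁻¹ * ∫ θ in 0..2 * π, g θ * cos θ

/-- The Fourier coefficient of `sin`. -/
noncomputable def sinMode (g : ℝ → ℝ) : ℝ := π⁻¹ * ∫ θ in 0..2 * π, g θ * sin θ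

/-- The part of a function on the circle that consists of the modes of order at least two. -/
noncomputable def highPart (g : ℝ → ℝ) (θ : ℝ) : ℝ :=
  g θ - meanMode g - cosMode g * cos θ - sinMode g * sin θ

theorem integral_cos_two_pi : ∫ θ in 0..2 * π, cos θ = 0 := by simp

theorem integral_sin_two_pi : ∫ θ in 0..2 * π, sin θ = 0 := by simp

theorem integral_cos_sq_two_pi : ∫ θ in 0..2 * π, cos θ ^ 2 = π := by
  rw [integral_cos_sq]; simp

theorem integral_sin_sq_two_pi : ∫ θ in 0..2 * π, sin θ ^ 2 = π := by
  rw [integral_sin_sq]; simp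

theorem integral_sin_mul_cos_two_pi : ∫ θ in 0..2 * π, sin θ * cos θ = 0 := by
  rw [integral_sin_mul_cos₁]; simp

theorem integral_eq_meanMode (g : ℝ → ℝ) : ∫ θ in 0..2 * π, g θ = 2 * π * meanMode g := by
  unfold meanMode; field_simp

theorem integral_mul_cos_eq (g : ℝ → ℝ) : ∫ θ in 0..2 * π, g θ * cos θ = π * cosMode g := by
  unfold cosMode; field_simp

theorem integral_mul_sin_eq (g : ℝ → ℝ) : ∫ θ in 0..2 * π, g θ * sin θ = π * sinMode g := by
  unfold sinMode; field_simp

theorem continuous_highPart {g : ℝ → ℝ} (hg : Continuous g) : Continuous (highPart g) := by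
  unfold highPart; fun_prop

theorem integral_highPart_mul {g w : ℝ → ℝ} (hg : Continuous g) (hw : Continuous w) :
    ∫ θ in 0..2 * π, highPart g θ * w θ = (∫ θ in 0..2 * π, g θ * w θ)
      - meanMode g * (∫ θ in 0..2 * π, w θ) - cosMode g * (∫ θ in 0..2 * π, w θ * cos θ)
      - sinMode g * ∫ θ in 0..2 * π, w θ * sin θ := by
  have e : ∀ θ, highPart g θ * w θ = g θ * w θ - meanMode g * w θ - cosMode g * (w θ * cos θ)
      - sinMode g * (w θ * sin θ) := fun θ => by unfold highPart; ring
  simp_rw [e]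
  rw [intervalIntegral.integral_sub, intervalIntegral.integral_sub, intervalIntegral.integral_sub]
  · simp only [intervalIntegral.integral_const_mul]
  all_goals exact Continuous.intervalIntegrable (by fun_prop) _ _

theorem integral_highPart {g : ℝ → ℝ} (hg : Continuous g) :
    ∫ θ in 0..2 * π, highPart g θ = 0 := by
  have := integral_highPart_mul hg (w := fun _ => 1) continuous_const
  simp only [mul_one, one_mul, integral_cos_two_pi, integral_sin_two_pi] at this
  rw [this, integral_eq_meanMode]; simp; ring

theorem integral_highPart_mul_cos {g : ℝ → ℝ} (hg : Continuous g) :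
    ∫ θ in 0..2 * π, highPart g θ * cos θ = 0 := by
  rw [integral_highPart_mul hg continuous_cos]
  simp only [← sq, integral_cos_sq_two_pi, integral_cos_two_pi, mul_comm (cos _) (sin _),
    integral_sin_mul_cos_two_pi, integral_mul_cos_eq]
  ring

theorem integral_highPart_mul_sin {g : ℝ → ℝ} (hg : Continuous g) :
    ∫ θ in 0..2 * π, highPart g θ * sin θ = 0 := by
  rw [integral_highPart_mul hg continuous_sin]
  simp only [← sq, integral_sin_sq_two_pi, integral_sin_two_pi,
    integral_sin_mul_cos_two_pi, integral_mul_sin_eq]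
  ring

/-- The high part is orthogonal to `1`, `cos` and `sin`, so no mixed terms survive. Splitting off
three modes by hand avoids a full Fourier series in the later estimates. -/
theorem integral_mul_eq_modes {g k : ℝ → ℝ} (hg : Continuous g) (hk : Continuous k) :
    ∫ θ in 0..2 * π, g θ * k θ = 2 * π * (meanMode g * meanMode k)
      + π * (cosMode g * cosMode k) + π * (sinMode g * sinMode k)
      + ∫ θ in 0..2 * π, highPart g θ * highPart k θ := by
  have h1 := integral_highPart_mul hg (continuous_highPart hk)
  rw [integral_highPart hk, integral_highPart_mul_cos hk, integral_highPart_mul_sin hk] at h1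
  have h2 := integral_highPart_mul hk hg
  rw [integral_eq_meanMode g, integral_mul_cos_eq g, integral_mul_sin_eq g] at h2
  simp_rw [mul_comm (highPart k _) (g _), mul_comm (k _) (g _)] at h2
  linarith

theorem integral_sq_eq_modes {g : ℝ → ℝ} (hg : Continuous g) :
    ∫ θ in 0..2 * π, g θ ^ 2 = 2 * π * meanMode g ^ 2 + π * cosMode g ^ 2 + π * sinMode g ^ 2
      + ∫ θ in 0..2 * π, highPart g θ ^ 2 := by
  simpa only [sq] using integral_mul_eq_modes hg hg

/-! ### Derivatives of periodic functions -/

theorem integral_deriv_mul_periodic {g g' w w' : ℝ → ℝ} (hg : ∀ θ, HasDerivAt g (g' θ) θ)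
    (hg' : Continuous g') (hw : ∀ θ, HasDerivAt w (w' θ) θ) (hw' : Continuous w')
    (hgp : g (2 * π) = g 0) (hwp : w (2 * π) = w 0) :
    ∫ θ in 0..2 * π, g' θ * w θ = -∫ θ in 0..2 * π, g θ * w' θ := by
  rw [intervalIntegral.integral_mul_deriv_eq_deriv_mul (fun x _ => hg x) (fun x _ => hw x)
    (hg'.intervalIntegrable _ _) (hw'.intervalIntegrable _ _), hgp, hwp]
  ring

theorem meanMode_deriv {g g' : ℝ → ℝ} (hg : ∀ θ, HasDerivAt g (g' θ) θ) (hg' : Continuous g')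
    (hgp : g (2 * π) = g 0) : meanMode g' = 0 := by
  unfold meanMode
  rw [intervalIntegral.integral_eq_sub_of_hasDerivAt (fun x _ => hg x)
    (hg'.intervalIntegrable _ _), hgp]
  simp

theorem cosMode_deriv {g g' : ℝ → ℝ} (hg : ∀ θ, HasDerivAt g (g' θ) θ) (hg' : Continuous g')
    (hgp : g (2 * π) = g 0) : cosMode g' = sinMode g := by
  unfold cosMode sinMode
  rw [integral_deriv_mul_periodic hg hg' hasDerivAt_cos (by fun_prop) hgp (by simp)]
  simp

theorem sinMode_deriv {g g' : ℝ → ℝ} (hg : ∀ θ, HasDerivAt g (g' θ) θ) (hg' : Continuous g')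
    (hgp : g (2 * π) = g 0) : sinMode g' = -cosMode g := by
  unfold cosMode sinMode
  rw [integral_deriv_mul_periodic hg hg' hasDerivAt_sin (by fun_prop) hgp (by simp)]
  simp

/-- Wirtinger's inequality for functions without modes of order zero and one. -/
theorem wirtinger_of_modes {g g' : ℝ → ℝ} (hg : ∀ θ, HasDerivAt g (g' θ) θ)
    (hg' : Continuous g') (hgp : g (2 * π) = g 0) (h0 : ∫ θ in 0..2 * π, g θ = 0)
    (h1 : ∫ θ in 0..2 * π, g θ * cos θ = 0) (h2 : ∫ θ in 0..2 * π, g θ * sin θ = 0) :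
    4 * ∫ θ in 0..2 * π, g θ ^ 2 ≤ ∫ θ in 0..2 * π, g' θ ^ 2 := by
  have hpos : (0 : ℝ) < 2 * π := two_pi_pos
  have hgc : Continuous g := continuous_iff_continuousAt.2 fun x => (hg x).continuousAt
  have key : ∀ k : ℝ → ℝ, Continuous k →
      HasSum (fun n => ‖fourierCoeffOn hpos (fun x => (k x : ℂ)) n‖ ^ 2)
        ((2 * π)⁻¹ * ∫ θ in 0..2 * π, k θ ^ 2) := by
    intro k hk
    have hL : MemLp (fun x => (k x : ℂ)) 2 (volume.restrict (Set.Ioc 0 (2 * π))) := by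
      have hb := (isCompact_Icc (a := (0 : ℝ)) (b := 2 * π)).exists_bound_of_continuousOn
        (f := fun x => (k x : ℂ)) (by fun_prop)
      obtain ⟨C, hC⟩ := hb
      refine MemLp.of_bound (Continuous.aestronglyMeasurable (by fun_prop)) C ?_
      filter_upwards [ae_restrict_mem measurableSet_Ioc] with x hx
      exact hC x ⟨hx.1.le, hx.2⟩
    have := hasSum_sq_fourierCoeffOn hpos hL
    simpa using this
  have hG := key g hgc
  have hG' := key g' hg'
  -- By Parseval it is enough to compare coefficients. Those of `g` with `|n| ≤ 1` vanish by `h0`,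
  -- `h1`, `h2`; for the others, differentiation multiplies by `i n`, and `n² ≥ 4`.
  have hle : ∀ n : ℤ, 4 * ‖fourierCoeffOn hpos (fun x => (g x : ℂ)) n‖ ^ 2 ≤
      ‖fourierCoeffOn hpos (fun x => (g' x : ℂ)) n‖ ^ 2 := by
    intro n
    have hcoef : ∀ n : ℤ, |n| ≤ 1 → fourierCoeffOn hpos (fun x => (g x : ℂ)) n = 0 := by
      intro n hn
      rw [fourierCoeffOn_eq_integral]
      have e : ∀ x : ℝ, fourier (-n) (x : AddCircle (2 * π - 0)) • (g x : ℂ)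
          = ((g x * cos (n * x) : ℝ) : ℂ) - ((g x * sin (n * x) : ℝ) : ℂ) * Complex.I := by
        intro x
        rw [fourier_coe_apply]
        have : 2 * (π : ℂ) * Complex.I * ((-n : ℤ) : ℂ) * x / ((2 * π - 0 : ℝ) : ℂ)
            = ((-(n * x) : ℝ) : ℂ) * Complex.I := by
          have : (π : ℂ) ≠ 0 := by exact_mod_cast pi_ne_zero
          push_cast; field_simp; ring
        rw [this, Complex.exp_mul_I, ← Complex.ofReal_cos, ← Complex.ofReal_sin, cos_neg, sin_neg]
        simp only [smul_eq_mul]; push_cast; ring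
      simp_rw [e]
      rw [intervalIntegral.integral_sub, intervalIntegral.integral_mul_const,
        intervalIntegral.integral_ofReal, intervalIntegral.integral_ofReal]
      · have hn' : n = -1 ∨ n = 0 ∨ n = 1 := by rw [abs_le] at hn; omega
        rcases hn' with rfl | rfl | rfl
        · simp [h1, h2]
        · simp [h0]
        · simp [h1, h2]
      all_goals exact Continuous.intervalIntegrable (by fun_prop) _ _
    by_cases hn : |n| ≤ 1
    · rw [hcoef n hn]; simp
    · have hn0 : n ≠ 0 := by rintro rfl; simp at hn
      have hd := fourierCoeffOn_of_hasDerivAt hpos hn0 (f := fun x => (g x : ℂ))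
        (f' := fun x => (g' x : ℂ)) (fun x _ => (hg x).ofReal_comp)
        (Continuous.intervalIntegrable (by fun_prop) _ _)
      rw [hgp] at hd
      have hn2 : (2 : ℝ) ≤ |(n : ℝ)| := by
        have : 2 ≤ |n| := by omega
        exact_mod_cast this
      have hd' : fourierCoeffOn hpos (fun x => (g' x : ℂ)) n
          = (Complex.I * n) * fourierCoeffOn hpos (fun x => (g x : ℂ)) n := by
        rw [hd]
        have hpi : (π : ℂ) ≠ 0 := by exact_mod_cast pi_ne_zero
        have hnc : (n : ℂ) ≠ 0 := by exact_mod_cast hn0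
        push_cast
        field_simp
        ring
      rw [hd', norm_mul, norm_mul, Complex.norm_I, one_mul, mul_pow]
      have : ‖(n : ℂ)‖ = |(n : ℝ)| := by simp
      rw [this]
      gcongr
      nlinarith
  have := hasSum_le hle (hG.mul_left 4) hG'
  have hp : 0 < (2 * π)⁻¹ := by positivity
  rw [← mul_assoc, mul_comm (4 : ℝ), mul_assoc] at this
  exact le_of_mul_le_mul_left this hp

/-- Differentiation rotates the pair of `cos` and `sin` coefficients, kills the mean and commutes
with `highPart`. The modes of order one thus contribute with factor `1`, and the remainder with
Wirtinger's factor `4`. -/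
theorem wirtinger_highPart {g g' : ℝ → ℝ} (hg : ∀ θ, HasDerivAt g (g' θ) θ)
    (hg' : Continuous g') (hgp : g (2 * π) = g 0) :
    π * cosMode g ^ 2 + π * sinMode g ^ 2 + 4 * ∫ θ in 0..2 * π, highPart g θ ^ 2
      ≤ ∫ θ in 0..2 * π, g' θ ^ 2 := by
  have hgc : Continuous g := continuous_iff_continuousAt.2 fun x => (hg x).continuousAt
  rw [integral_sq_eq_modes hg', meanMode_deriv hg hg' hgp, cosMode_deriv hg hg' hgp,
    sinMode_deriv hg hg' hgp]
  have hd : ∀ θ, HasDerivAt (highPart g) (highPart g' θ) θ := by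
    intro θ
    have h := (((hg θ).sub_const (meanMode g)).sub
      ((hasDerivAt_cos θ).const_mul (cosMode g))).sub ((hasDerivAt_sin θ).const_mul (sinMode g))
    refine h.congr_deriv ?_
    simp only [highPart, meanMode_deriv hg hg' hgp, cosMode_deriv hg hg' hgp,
      sinMode_deriv hg hg' hgp]
    ring
  have := wirtinger_of_modes hd (continuous_highPart hg') (by simp [highPart, hgp])
    (integral_highPart hgc) (integral_highPart_mul_cos hgc) (integral_highPart_mul_sin hgc)
  linarith

/-! ### One-dimensional inequalities for the radial parts of the modes -/

/-- Picone's inequality for the Legendre operator, with the comparison function `U (cos ρ)`. -/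
theorem picone_legendre {U U₁ U₂ h h' : ℝ → ℝ} {x y κ : ℝ} (hxy : x ≤ y) (hx : 0 ≤ x) (hy : y ≤ π)
    (hU : ∀ t, HasDerivAt U (U₁ t) t) (hU₁ : ∀ t, HasDerivAt U₁ (U₂ t) t) (hU₂ : Continuous U₂)
    (hpos : ∀ ρ ∈ Set.Icc x y, 0 < U (cos ρ))
    (hsup : ∀ ρ ∈ Set.Icc x y,
      (1 - cos ρ ^ 2) * U₂ (cos ρ) - 2 * cos ρ * U₁ (cos ρ) ≤ -(κ * U (cos ρ)))
    (hh : ∀ ρ, HasDerivAt h (h' ρ) ρ) (hh' : Continuous h') :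
    κ * (∫ ρ in x..y, sin ρ * h ρ ^ 2) - (sin y ^ 2 * U₁ (cos y) / U (cos y) * h y ^ 2
      - sin x ^ 2 * U₁ (cos x) / U (cos x) * h x ^ 2) ≤ ∫ ρ in x..y, sin ρ * h' ρ ^ 2 := by
  have hUc : Continuous U := continuous_iff_continuousAt.2 fun t => (hU t).continuousAt
  have hU₁c : Continuous U₁ := continuous_iff_continuousAt.2 fun t => (hU₁ t).continuousAt
  have hhc : Continuous h := continuous_iff_continuousAt.2 fun t => (hh t).continuousAt
  -- The derivative of `sin² ρ · U₁ / U · h²`, arranged so that the Legendre operator applied to `U`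
  -- appears in the first term.
  set w : ℝ → ℝ := fun ρ => sin ρ * (-((1 - cos ρ ^ 2) * U₂ (cos ρ) - 2 * cos ρ * U₁ (cos ρ)))
    / U (cos ρ) * h ρ ^ 2 + sin ρ ^ 3 * U₁ (cos ρ) ^ 2 / U (cos ρ) ^ 2 * h ρ ^ 2
    + sin ρ ^ 2 * U₁ (cos ρ) / U (cos ρ) * (2 * h ρ * h' ρ) with hw
  have hd : ∀ ρ ∈ Set.uIcc x y,
      HasDerivAt (fun ρ => sin ρ ^ 2 * U₁ (cos ρ) / U (cos ρ) * h ρ ^ 2) (w ρ) ρ := by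
    intro ρ hρ
    rw [Set.uIcc_of_le hxy] at hρ
    have hne := (hpos ρ hρ).ne'
    have h1 := (hU (cos ρ)).comp ρ (hasDerivAt_cos ρ)
    have h2 := (hU₁ (cos ρ)).comp ρ (hasDerivAt_cos ρ)
    have h3 := (((((hasDerivAt_sin ρ).pow 2).mul h2).div h1 hne).mul ((hh ρ).pow 2))
    refine h3.congr_deriv ?_
    have hs : 1 - cos ρ ^ 2 = sin ρ ^ 2 := by rw [sin_sq]
    simp only [hw, Function.comp, Pi.mul_apply, Pi.div_apply, Pi.pow_apply, hs]
    field_simp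
    ring
  have hwc : ContinuousOn w (Set.uIcc x y) := by
    rw [Set.uIcc_of_le hxy]
    have hne : ∀ ρ ∈ Set.Icc x y, U (cos ρ) ≠ 0 := fun ρ hρ => (hpos ρ hρ).ne'
    have hne2 : ∀ ρ ∈ Set.Icc x y, U (cos ρ) ^ 2 ≠ 0 := fun ρ hρ => pow_ne_zero 2 (hne ρ hρ)
    refine ContinuousOn.add (ContinuousOn.add (ContinuousOn.mul (ContinuousOn.div ?_ ?_ hne) ?_)
      (ContinuousOn.mul (ContinuousOn.div ?_ ?_ hne2) ?_))
      (ContinuousOn.mul (ContinuousOn.div ?_ ?_ hne) ?_) <;> fun_prop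
  rw [← intervalIntegral.integral_eq_sub_of_hasDerivAt hd hwc.intervalIntegrable,
    ← intervalIntegral.integral_const_mul, ← intervalIntegral.integral_sub]
  · refine intervalIntegral.integral_mono_on hxy ?_ ?_ ?_
    · exact (Continuous.intervalIntegrable (by fun_prop) _ _).sub hwc.intervalIntegrable
    · exact Continuous.intervalIntegrable (by fun_prop) _ _
    · intro ρ hρ
      have hp := hpos ρ hρ
      have hsin : 0 ≤ sin ρ := sin_nonneg_of_nonneg_of_le_pi (hx.trans hρ.1) (hρ.2.trans hy)
      -- With `u ρ = U (cos ρ)` we have `u' = -sin ρ · U₁`, so this is Picone's square `sin ρ (h' -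
      -- (u' / u) h)²`.
      have h1 : 0 ≤ sin ρ * (h' ρ + sin ρ * U₁ (cos ρ) / U (cos ρ) * h ρ) ^ 2 := by positivity
      have h2 : κ ≤ -((1 - cos ρ ^ 2) * U₂ (cos ρ) - 2 * cos ρ * U₁ (cos ρ)) / U (cos ρ) := by
        rw [le_div_iff₀ hp]; linarith [hsup ρ hρ]
      have h3 : κ * (sin ρ * h ρ ^ 2) ≤ -((1 - cos ρ ^ 2) * U₂ (cos ρ)
          - 2 * cos ρ * U₁ (cos ρ)) / U (cos ρ) * (sin ρ * h ρ ^ 2) := by gcongr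
      have h4 : sin ρ * (h' ρ + sin ρ * U₁ (cos ρ) / U (cos ρ) * h ρ) ^ 2 = sin ρ * h' ρ ^ 2
          + w ρ - -((1 - cos ρ ^ 2) * U₂ (cos ρ)
          - 2 * cos ρ * U₁ (cos ρ)) / U (cos ρ) * (sin ρ * h ρ ^ 2) := by
        simp only [hw]; ring
      linarith
  · exact Continuous.intervalIntegrable (by fun_prop) _ _
  · exact hwc.intervalIntegrable

/-- Subtracting a constant from a function of mean zero does not decrease the weighted norm. -/
theorem weighted_sq_le_sub_const {f : ℝ → ℝ} (hf : Continuous f) {A : ℝ}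
    (hmean : 2 * (∫ ρ in 0..A, sin ρ * f ρ) + cos A * f A = 0) (c : ℝ) :
    2 * (∫ ρ in 0..A, sin ρ * f ρ ^ 2) + cos A * f A ^ 2 ≤
      2 * (∫ ρ in 0..A, sin ρ * (f ρ - c) ^ 2) + cos A * (f A - c) ^ 2 := by
  have e : ∀ ρ, sin ρ * (f ρ - c) ^ 2 = sin ρ * f ρ ^ 2 - 2 * c * (sin ρ * f ρ) + c ^ 2 * sin ρ :=
    fun ρ => by ring
  simp_rw [e]
  rw [intervalIntegral.integral_add, intervalIntegral.integral_sub]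
  · simp only [intervalIntegral.integral_const_mul, integral_sin, cos_zero]
    -- The cross term vanishes by `hmean`; what remains is `c²` times the total weight `2 (1 - cos
    -- A) + cos A`.
    have h1 : 0 ≤ c ^ 2 * (2 - cos A) := mul_nonneg (sq_nonneg c) (by linarith [cos_le_one A])
    linear_combination h1 + 2 * c * hmean
  all_goals exact Continuous.intervalIntegrable (by fun_prop) _ _

/-- The comparison function is twice the Legendre polynomial `P₂`, with eigenvalue `6`, well above
the required `11/5 = 2 · 11/10`. It is positive for `t > 1/√3`, in particular for `t ≥ 3/5`. The
boundary terms vanish because `sin 0 = 0` and `h B = 0`. -/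
theorem picone_outer {h h' : ℝ → ℝ} (hh : ∀ ρ, HasDerivAt h (h' ρ) ρ) (hh' : Continuous h')
    {B : ℝ} (hB : 0 ≤ B) (hBπ : B ≤ π) (hcos : 3 / 5 ≤ cos B) (hz : h B = 0) :
    11 / 5 * (∫ ρ in 0..B, sin ρ * h ρ ^ 2) ≤ ∫ ρ in 0..B, sin ρ * h' ρ ^ 2 := by
  have hc : ∀ ρ ∈ Set.Icc 0 B, 3 / 5 ≤ cos ρ := fun ρ hρ =>
    hcos.trans (cos_le_cos_of_nonneg_of_le_pi hρ.1 hBπ hρ.2)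
  have := picone_legendre (U := fun t => 3 * t ^ 2 - 1) (U₁ := fun t => 6 * t) (U₂ := fun _ => 6)
    (κ := 11 / 5) hB le_rfl hBπ
    (fun t => (((hasDerivAt_pow 2 t).const_mul 3).sub_const 1).congr_deriv (by norm_num; ring))
    (fun t => ((hasDerivAt_id t).const_mul 6).congr_deriv (by norm_num)) continuous_const
    (fun ρ hρ => by nlinarith [hc ρ hρ]) (fun ρ hρ => by nlinarith [hc ρ hρ]) hh hh'
  simpa [hz] using this

/-- On `0 ≤ t ≤ 3/5` the polynomial `1 - 5/4 t² - 4/5 t⁴` is a positive supersolution. Being even,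
it has a derivative with a factor `t`, so the boundary term at `A` carries the factor `cos A` that
the boundary weight requires, and vanishes on the equator as it must. At `B` the boundary term is
zero since `h B = 0`. -/
theorem picone_inner {h h' : ℝ → ℝ} (hh : ∀ ρ, HasDerivAt h (h' ρ) ρ) (hh' : Continuous h')
    {A B : ℝ} (hB : 0 ≤ B) (hBA : B ≤ A) (hA : A ≤ π / 2) (hcos : cos B = 3 / 5) (hz : h B = 0) :
    11 / 5 * (∫ ρ in B..A, sin ρ * h ρ ^ 2) + 11 / 10 * (cos A * h A ^ 2)
      ≤ ∫ ρ in B..A, sin ρ * h' ρ ^ 2 := by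
  have hπ : A ≤ π := by linarith [pi_pos]
  have hc : ∀ ρ ∈ Set.Icc B A, 0 ≤ cos ρ ∧ cos ρ ≤ 3 / 5 := fun ρ hρ =>
    ⟨cos_nonneg_of_neg_pi_div_two_le_of_le (by linarith [pi_pos, hρ.1]) (hρ.2.trans hA),
      hcos ▸ cos_le_cos_of_nonneg_of_le_pi hB (hρ.2.trans hπ) hρ.1⟩
  have hU : ∀ t : ℝ, 0 ≤ t → t ≤ 3 / 5 → 0 < 1 - 5 / 4 * t ^ 2 - 4 / 5 * t ^ 4 := by
    intro t h0 h1
    have h2 : t ^ 2 ≤ 9 / 25 := by nlinarith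
    nlinarith [sq_nonneg t]
  have := picone_legendre (U := fun t => 1 - 5 / 4 * t ^ 2 - 4 / 5 * t ^ 4)
    (U₁ := fun t => -(5 / 2 * t) - 16 / 5 * t ^ 3) (U₂ := fun t => -(5 / 2) - 48 / 5 * t ^ 2)
    (κ := 11 / 5) hBA hB hπ
    (fun t => ((((hasDerivAt_pow 2 t).const_mul (5 / 4)).const_sub 1).sub
      ((hasDerivAt_pow 4 t).const_mul (4 / 5))).congr_deriv (by norm_num; ring))
    (fun t => ((((hasDerivAt_id t).const_mul (5 / 2)).neg).sub
      ((hasDerivAt_pow 3 t).const_mul (16 / 5))).congr_deriv (by norm_num; ring)) (by fun_prop)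
    (fun ρ hρ => hU _ (hc ρ hρ).1 (hc ρ hρ).2)
    (fun ρ hρ => by
      obtain ⟨h0, h1⟩ := hc ρ hρ
      have h2 : cos ρ ^ 2 ≤ 9 / 25 := by nlinarith
      nlinarith [sq_nonneg (cos ρ)]) hh hh'
  rw [hz] at this
  obtain ⟨h0, h1⟩ := hc A ⟨hBA, le_rfl⟩
  have hp := hU _ h0 h1
  have hb : 11 / 10 * cos A ≤ -(sin A ^ 2 * (-(5 / 2 * cos A) - 16 / 5 * cos A ^ 3) /
      (1 - 5 / 4 * cos A ^ 2 - 4 / 5 * cos A ^ 4)) := by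
    rw [← neg_div, le_div_iff₀ hp, sin_sq]
    have h2 : cos A ^ 2 ≤ 9 / 25 := by nlinarith
    -- With denominators cleared, the difference of the two sides of the goal is `cos A` times this
    -- polynomial.
    have h3 : 0 ≤ 7 / 5 + 83 / 40 * cos A ^ 2 - 58 / 25 * cos A ^ 4 := by nlinarith [sq_nonneg (cos A)]
    nlinarith [mul_nonneg h0 h3]
  have := mul_le_mul_of_nonneg_right hb (sq_nonneg (h A))
  linarith

/-- For mean zero, `weighted_sq_le_sub_const` permits subtracting any constant, so a zero of the
function can be placed where it is useful. On a small cap (`cos A ≥ 3/5`) it is placed at `A`, which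
removes the boundary term. Otherwise it is placed at the angle `B` with `cos B = 3/5`, and the two
pieces have their own comparison functions. -/
theorem mode_zero_gap {f f' : ℝ → ℝ} (hf : ∀ ρ, HasDerivAt f (f' ρ) ρ) (hf' : Continuous f')
    {A : ℝ} (hA : 0 ≤ A) (hA' : A ≤ π / 2)
    (hmean : 2 * (∫ ρ in 0..A, sin ρ * f ρ) + cos A * f A = 0) :
    11 / 10 * (2 * (∫ ρ in 0..A, sin ρ * f ρ ^ 2) + cos A * f A ^ 2)
      ≤ ∫ ρ in 0..A, sin ρ * f' ρ ^ 2 := by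
  have hfc : Continuous f := continuous_iff_continuousAt.2 fun t => (hf t).continuousAt
  have hπ : A ≤ π := by linarith [pi_pos]
  by_cases hcA : 3 / 5 ≤ cos A
  · have h1 := weighted_sq_le_sub_const hfc hmean (f A)
    have h2 := picone_outer (fun ρ => (hf ρ).sub_const (f A)) hf' hA hπ hcA (by simp)
    simp only [sub_self] at h1
    linarith
  · push Not at hcA
    obtain ⟨B, hB0, hBA, hB⟩ : ∃ B, 0 ≤ B ∧ B ≤ A ∧ cos B = 3 / 5 := by
      obtain ⟨B, hB, hB'⟩ := intermediate_value_Icc' hA (continuous_cos.continuousOn (s := Set.Icc 0 A))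
        (show (3 / 5 : ℝ) ∈ Set.Icc (cos A) (cos 0) from ⟨hcA.le, by rw [cos_zero]; norm_num⟩)
      exact ⟨B, hB.1, hB.2, hB'⟩
    have h1 := weighted_sq_le_sub_const hfc hmean (f B)
    have h2 := picone_outer (fun ρ => (hf ρ).sub_const (f B)) hf' hB0 (hBA.trans hπ) hB.ge (by simp)
    have h3 := picone_inner (fun ρ => (hf ρ).sub_const (f B)) hf' hB0 hBA hA' hB (by simp)
    rw [← intervalIntegral.integral_add_adjacent_intervals (a := 0) (b := B) (c := A)] at h1 ⊢
    · rw [← intervalIntegral.integral_add_adjacent_intervals (a := 0) (b := B) (c := A)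
        (f := fun ρ => sin ρ * (f ρ - f B) ^ 2)] at h1
      · rw [← intervalIntegral.integral_add_adjacent_intervals (a := 0) (b := B) (c := A)]
        · linarith
        all_goals exact Continuous.intervalIntegrable (by fun_prop) _ _
      all_goals exact Continuous.intervalIntegrable (by fun_prop) _ _
    all_goals exact Continuous.intervalIntegrable (by fun_prop) _ _

/-- A lower bound, regular at `ρ = 0`, for the energy density `sin ρ a'² + a² / sin ρ` of a mode of
order one; `k` is a parameter. -/
noncomputable def modeOneBound (k : ℝ) (a a' : ℝ → ℝ) (ρ : ℝ) : ℝ :=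
  sin ρ * a ρ ^ 2 + 2 * cos ρ * a ρ * a' ρ - sin ρ / 4 * (a ρ - k * sin ρ) ^ 2
    - (1 - cos ρ) * (a ρ - k * sin ρ) * (a' ρ - k * cos ρ)

/-- Picone's square for the comparison function `sin` would be `s (a' - (c/s) a)²`. It is perturbed
by `(1 - c)/(2s) · g`, where `g = a - k s`, before being expanded. The resulting `g²` coefficient is
`(1 - c)(5c - 1)/(4s)`, which is at least `-s/4` because `c ≥ 0`; this leaves no division by `s` in
the bound. -/
theorem modeOneBound_le (k : ℝ) (a a' : ℝ → ℝ) {ρ : ℝ} (hs : 0 < sin ρ) (hc : 0 ≤ cos ρ) :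
    modeOneBound k a a' ρ ≤ sin ρ * a' ρ ^ 2 + a ρ ^ 2 / sin ρ := by
  unfold modeOneBound
  have hsc := sin_sq_add_cos_sq ρ
  set s := sin ρ
  set c := cos ρ
  have hc1 : c ≤ 1 := cos_le_one ρ
  have h1 : 0 ≤ s * (a' ρ - c / s * a ρ + (1 - c) / (2 * s) * (a ρ - k * s)) ^ 2 := by positivity
  have hs2 : s ^ 2 = (1 - c) * (1 + c) := by linarith
  have h2 : ((1 - c) * c / s - (1 - c) ^ 2 / (4 * s)) * (a ρ - k * s) ^ 2
      ≥ -(s / 4) * (a ρ - k * s) ^ 2 := by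
    refine mul_le_mul_of_nonneg_right ?_ (sq_nonneg _)
    rw [show (1 - c) * c / s - (1 - c) ^ 2 / (4 * s) = (1 - c) * (5 * c - 1) / (4 * s) by
      field_simp; ring, le_div_iff₀ (by positivity)]
    nlinarith [mul_nonneg (sub_nonneg.2 hc1) hc]
  have h3 : s * (a' ρ - c / s * a ρ + (1 - c) / (2 * s) * (a ρ - k * s)) ^ 2
      = s * a' ρ ^ 2 + a ρ ^ 2 / s - s * a ρ ^ 2 - 2 * c * a ρ * a' ρ
        + (1 - c) * (a ρ - k * s) * (a' ρ - k * c)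
        - ((1 - c) * c / s - (1 - c) ^ 2 / (4 * s)) * (a ρ - k * s) ^ 2 := by
    have : a ρ ^ 2 / s = c ^ 2 / s * a ρ ^ 2 + s * a ρ ^ 2 := by
      field_simp; linear_combination (-(a ρ ^ 2)) * hsc
    rw [this]
    field_simp
    ring
  linarith

theorem continuous_modeOneBound {a a' : ℝ → ℝ} (ha : Continuous a) (ha' : Continuous a') (k : ℝ) :
    Continuous (modeOneBound k a a') := by
  unfold modeOneBound; fun_prop

/-- Write `g = a - k sin` and let `N = 2 ∫ sin · a² + cos A · a(A)²`. Up to a total derivative the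
integrand is `2 sin · a² + (1/4) sin · g²`. The choice `k = a(A) / sin A` makes `g(A) = 0`, so the
integral is `N + (1/4) ∫ sin · g²`. By `hmean` the cross term in `g²` contributes `+ (1/4) cos A ·
a(A)²`, whence the surplus is at least `N / 8`. -/
theorem mode_one_gap {a a' : ℝ → ℝ} (ha : ∀ ρ, HasDerivAt a (a' ρ) ρ) (ha' : Continuous a')
    {A : ℝ} (hA : 0 < A) (hA' : A ≤ π / 2) (h0 : a 0 = 0)
    (hmean : 2 * (∫ ρ in 0..A, sin ρ ^ 2 * a ρ) + cos A * sin A * a A = 0) :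
    9 / 8 * (2 * (∫ ρ in 0..A, sin ρ * a ρ ^ 2) + cos A * a A ^ 2)
      ≤ ∫ ρ in 0..A, modeOneBound (a A / sin A) a a' ρ := by
  have hac : Continuous a := continuous_iff_continuousAt.2 fun t => (ha t).continuousAt
  have hsA : 0 < sin A := sin_pos_of_pos_of_lt_pi hA (by linarith [pi_pos])
  have hcA : 0 ≤ cos A := cos_nonneg_of_neg_pi_div_two_le_of_le (by linarith) hA'
  set k := a A / sin A with hk
  have hkA : a A = k * sin A := by rw [hk]; field_simp
  have hd : ∀ ρ, HasDerivAt (fun ρ => cos ρ * a ρ ^ 2 - (1 - cos ρ) / 2 * (a ρ - k * sin ρ) ^ 2)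
      (-sin ρ * a ρ ^ 2 + cos ρ * (2 * a ρ * a' ρ) - (sin ρ / 2 * (a ρ - k * sin ρ) ^ 2
        + (1 - cos ρ) / 2 * (2 * (a ρ - k * sin ρ) * (a' ρ - k * cos ρ)))) ρ := by
    intro ρ
    refine ((((hasDerivAt_cos ρ).mul ((ha ρ).pow 2))).sub
      ((((hasDerivAt_cos ρ).const_sub 1).div_const 2).mul
        (((ha ρ).sub ((hasDerivAt_sin ρ).const_mul k)).pow 2))).congr_deriv ?_
    simp
  have e : ∀ ρ, modeOneBound k a a' ρ = 2 * (sin ρ * a ρ ^ 2) + (-sin ρ * a ρ ^ 2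
      + cos ρ * (2 * a ρ * a' ρ) - (sin ρ / 2 * (a ρ - k * sin ρ) ^ 2
        + (1 - cos ρ) / 2 * (2 * (a ρ - k * sin ρ) * (a' ρ - k * cos ρ))))
      + (1 / 4 * (sin ρ * a ρ ^ 2) - k / 2 * (sin ρ ^ 2 * a ρ) + k ^ 2 / 4 * sin ρ ^ 3) := by
    intro ρ; unfold modeOneBound; ring
  simp_rw [e]
  have hnn : 0 ≤ ∫ ρ in 0..A, sin ρ ^ 3 :=
    intervalIntegral.integral_nonneg hA.le fun ρ hρ =>
      pow_nonneg (sin_nonneg_of_nonneg_of_le_pi hρ.1 (by linarith [pi_pos, hρ.2])) 3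
  rw [intervalIntegral.integral_add, intervalIntegral.integral_add,
    intervalIntegral.integral_eq_sub_of_hasDerivAt (fun x _ => hd x),
    intervalIntegral.integral_add, intervalIntegral.integral_sub]
  · simp only [intervalIntegral.integral_const_mul]
    have e2 : cos A * a A ^ 2 - (1 - cos A) / 2 * (a A - k * sin A) ^ 2
        - (cos 0 * a 0 ^ 2 - (1 - cos 0) / 2 * (a 0 - k * sin 0) ^ 2) = cos A * a A ^ 2 := by
      rw [h0, hkA]; simp
    rw [e2]
    -- The orthogonality condition, multiplied by `k` and using `k sin A = a A`.
    have e3 : k * (2 * (∫ ρ in 0..A, sin ρ ^ 2 * a ρ)) = -(cos A * a A ^ 2) := by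
      have : 2 * (∫ ρ in 0..A, sin ρ ^ 2 * a ρ) = -(cos A * sin A * a A) := by linarith
      rw [this]; nth_rewrite 2 [hkA]; rw [hkA]; ring
    have : 0 ≤ k ^ 2 / 4 * ∫ ρ in 0..A, sin ρ ^ 3 := by positivity
    have h4 : 0 ≤ cos A * a A ^ 2 := by positivity
    nlinarith
  all_goals exact Continuous.intervalIntegrable (by fun_prop) _ _

/-- Picone's square with comparison function `sin² ρ`, the radial profile of the mode of order two
that is regular at the pole. -/
theorem mode_high_le (p p' : ℝ) {ρ : ℝ} (hs : 0 < sin ρ) :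
    4 * sin ρ * p ^ 2 + 4 * cos ρ * (p * p') ≤ sin ρ * p' ^ 2 + 4 * p ^ 2 / sin ρ := by
  have h1 : 0 ≤ sin ρ * (p' - 2 * cos ρ / sin ρ * p) ^ 2 := by positivity
  have h2 : sin ρ * (p' - 2 * cos ρ / sin ρ * p) ^ 2 = sin ρ * p' ^ 2 + 4 * p ^ 2 / sin ρ
      - 4 * sin ρ * p ^ 2 - 4 * cos ρ * (p * p') := by
    have hsc := sin_sq_add_cos_sq ρ
    field_simp
    linear_combination (4 * p ^ 2) * hsc
  linarith

/-! ### The spectral gap in polar coordinates -/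

theorem continuous_integral_circle {F : ℝ → ℝ → ℝ} (hF : Continuous (Function.uncurry F)) :
    Continuous fun ρ => ∫ θ in 0..2 * π, F ρ θ :=
  intervalIntegral.continuous_parametric_intervalIntegral_of_continuous' hF _ _

theorem hasDerivAt_integral_circle {F F' : ℝ → ℝ → ℝ} (hF : Continuous (Function.uncurry F))
    (hF' : Continuous (Function.uncurry F'))
    (hd : ∀ ρ θ, HasDerivAt (fun ρ => F ρ θ) (F' ρ θ) ρ) (ρ : ℝ) :
    HasDerivAt (fun ρ => ∫ θ in 0..2 * π, F ρ θ) (∫ θ in 0..2 * π, F' ρ θ) ρ := by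
  obtain ⟨C, hC⟩ := ((isCompact_Icc (a := ρ - 1) (b := ρ + 1)).prod
    (isCompact_Icc (a := (0 : ℝ)) (b := 2 * π))).exists_bound_of_continuousOn hF'.continuousOn
  have hFs : ∀ ρ, Continuous (F ρ) := fun ρ => hF.comp (by fun_prop : Continuous fun θ => (ρ, θ))
  have hFs' : ∀ ρ, Continuous (F' ρ) := fun ρ =>
    hF'.comp (by fun_prop : Continuous fun θ => (ρ, θ))
  refine (intervalIntegral.hasDerivAt_integral_of_dominated_loc_of_deriv_le (bound := fun _ => C)
    (F := F) (F' := F')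
    (Icc_mem_nhds (by linarith : ρ - 1 < ρ) (by linarith : ρ < ρ + 1)) ?_ ?_ ?_ ?_ ?_ ?_).2
  · exact .of_forall fun x => (hFs x).aestronglyMeasurable
  · exact (hFs ρ).intervalIntegrable _ _
  · exact (hFs' ρ).aestronglyMeasurable
  · refine .of_forall fun θ hθ x hx => hC (x, θ) ⟨hx, ?_⟩
    rw [Set.uIoc_of_le two_pi_pos.le] at hθ
    exact ⟨hθ.1.le, hθ.2⟩
  · exact intervalIntegrable_const
  · exact .of_forall fun θ _ x _ => hd x θ

/-- `G` is a continuously differentiable function in polar coordinates on the sphere, with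
derivative `Gρ` in the direction of the meridians and derivative `η` in the direction of the
circles of latitude. -/
structure IsPolarSmooth (G Gρ η : ℝ → ℝ → ℝ) : Prop where
  continuous : Continuous (Function.uncurry G)
  continuous_radial : Continuous (Function.uncurry Gρ)
  continuous_angular : Continuous (Function.uncurry η)
  hasDerivAt_radial : ∀ ρ θ, HasDerivAt (fun ρ => G ρ θ) (Gρ ρ θ) ρ
  hasDerivAt_angular : ∀ ρ θ, HasDerivAt (G ρ) (sin ρ * η ρ θ) θ
  periodic : ∀ ρ, G ρ (2 * π) = G ρ 0
  pole : ∀ θ, G 0 θ = G 0 0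

section Modes

variable {F F' : ℝ → ℝ → ℝ}

theorem continuous_meanMode (hF : Continuous (Function.uncurry F)) :
    Continuous fun ρ => meanMode (F ρ) :=
  continuous_const.mul (continuous_integral_circle hF)

theorem continuous_cosMode (hF : Continuous (Function.uncurry F)) :
    Continuous fun ρ => cosMode (F ρ) :=
  continuous_const.mul (continuous_integral_circle (F := fun ρ θ => F ρ θ * cos θ)
    (hF.mul (continuous_cos.comp continuous_snd)))

theorem continuous_sinMode (hF : Continuous (Function.uncurry F)) :
    Continuous fun ρ => sinMode (F ρ) :=
  continuous_const.mul (continuous_integral_circle (F := fun ρ θ => F ρ θ * sin θ)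
    (hF.mul (continuous_sin.comp continuous_snd)))

theorem continuous_uncurry_highPart (hF : Continuous (Function.uncurry F)) :
    Continuous (Function.uncurry fun ρ => highPart (F ρ)) :=
  ((hF.sub ((continuous_meanMode hF).comp continuous_fst)).sub
    (((continuous_cosMode hF).comp continuous_fst).mul (continuous_cos.comp continuous_snd))).sub
    (((continuous_sinMode hF).comp continuous_fst).mul (continuous_sin.comp continuous_snd))

theorem hasDerivAt_meanMode
    (hF : Continuous (Function.uncurry F)) (hF' : Continuous (Function.uncurry F'))
    (hd : ∀ ρ θ, HasDerivAt (fun ρ => F ρ θ) (F' ρ θ) ρ) (ρ : ℝ) :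
    HasDerivAt (fun ρ => meanMode (F ρ)) (meanMode (F' ρ)) ρ :=
  (hasDerivAt_integral_circle hF hF' hd ρ).const_mul _

theorem hasDerivAt_cosMode
    (hF : Continuous (Function.uncurry F)) (hF' : Continuous (Function.uncurry F'))
    (hd : ∀ ρ θ, HasDerivAt (fun ρ => F ρ θ) (F' ρ θ) ρ) (ρ : ℝ) :
    HasDerivAt (fun ρ => cosMode (F ρ)) (cosMode (F' ρ)) ρ :=
  (hasDerivAt_integral_circle (F := fun ρ θ => F ρ θ * cos θ) (F' := fun ρ θ => F' ρ θ * cos θ)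
    (hF.mul (continuous_cos.comp continuous_snd)) (hF'.mul (continuous_cos.comp continuous_snd))
    (fun ρ θ => (hd ρ θ).mul_const _) ρ).const_mul _

theorem hasDerivAt_sinMode
    (hF : Continuous (Function.uncurry F)) (hF' : Continuous (Function.uncurry F'))
    (hd : ∀ ρ θ, HasDerivAt (fun ρ => F ρ θ) (F' ρ θ) ρ) (ρ : ℝ) :
    HasDerivAt (fun ρ => sinMode (F ρ)) (sinMode (F' ρ)) ρ :=
  (hasDerivAt_integral_circle (F := fun ρ θ => F ρ θ * sin θ) (F' := fun ρ θ => F' ρ θ * sin θ)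
    (hF.mul (continuous_sin.comp continuous_snd)) (hF'.mul (continuous_sin.comp continuous_snd))
    (fun ρ θ => (hd ρ θ).mul_const _) ρ).const_mul _

theorem hasDerivAt_highPart
    (hF : Continuous (Function.uncurry F)) (hF' : Continuous (Function.uncurry F'))
    (hd : ∀ ρ θ, HasDerivAt (fun ρ => F ρ θ) (F' ρ θ) ρ) (ρ θ : ℝ) :
    HasDerivAt (fun ρ => highPart (F ρ) θ) (highPart (F' ρ) θ) ρ :=
  (((hd ρ θ).sub (hasDerivAt_meanMode hF hF' hd ρ)).sub
    ((hasDerivAt_cosMode hF hF' hd ρ).mul_const _)).sub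
    ((hasDerivAt_sinMode hF hF' hd ρ).mul_const _)

theorem hasDerivAt_integral_highPart_sq
    (hF : Continuous (Function.uncurry F)) (hF' : Continuous (Function.uncurry F'))
    (hd : ∀ ρ θ, HasDerivAt (fun ρ => F ρ θ) (F' ρ θ) ρ) (ρ : ℝ) :
    HasDerivAt (fun ρ => ∫ θ in 0..2 * π, highPart (F ρ) θ ^ 2)
      (2 * ∫ θ in 0..2 * π, highPart (F ρ) θ * highPart (F' ρ) θ) ρ := by
  rw [← intervalIntegral.integral_const_mul]
  refine hasDerivAt_integral_circle (F := fun ρ θ => highPart (F ρ) θ ^ 2)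
    (F' := fun ρ θ => 2 * (highPart (F ρ) θ * highPart (F' ρ) θ))
    (by simpa using! (continuous_uncurry_highPart hF).pow 2)
    (show Continuous fun p : ℝ × ℝ => 2 * (highPart (F p.1) p.2 * highPart (F' p.1) p.2) from
      continuous_const.mul ((continuous_uncurry_highPart hF).mul (continuous_uncurry_highPart hF')))
    (fun ρ θ => ((hasDerivAt_highPart hF hF' hd ρ θ).pow 2).congr_deriv ?_) ρ
  simp; ring

end Modes

/-- On each circle of latitude the radial energy splits by Parseval, while `wirtinger_highPart`
bounds the angular energy. The derivative in `θ` is `sin ρ · η`, so Wirtinger controls `sin² ρ ∫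
η²`, and dividing by `sin ρ` yields the singular terms `a² / sin ρ` and `4 p² / sin ρ` that the
one-dimensional bounds absorb. -/
theorem IsPolarSmooth.energy_density_ge {G Gρ η : ℝ → ℝ → ℝ} (h : IsPolarSmooth G Gρ η)
    (k l : ℝ) {ρ : ℝ} (hs : 0 < sin ρ) (hc : 0 ≤ cos ρ) :
    2 * π * (sin ρ * meanMode (Gρ ρ) ^ 2)
      + π * modeOneBound k (fun ρ => cosMode (G ρ)) (fun ρ => cosMode (Gρ ρ)) ρ
      + π * modeOneBound l (fun ρ => sinMode (G ρ)) (fun ρ => sinMode (Gρ ρ)) ρ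
      + (4 * sin ρ * (∫ θ in 0..2 * π, highPart (G ρ) θ ^ 2)
        + 4 * cos ρ * ∫ θ in 0..2 * π, highPart (G ρ) θ * highPart (Gρ ρ) θ)
    ≤ sin ρ * ∫ θ in 0..2 * π, (Gρ ρ θ ^ 2 + η ρ θ ^ 2) := by
  have c0 : Continuous (G ρ) := h.continuous.comp (by fun_prop : Continuous fun θ => (ρ, θ))
  have c1 : Continuous (Gρ ρ) :=
    h.continuous_radial.comp (by fun_prop : Continuous fun θ => (ρ, θ))
  have c2 : Continuous (η ρ) :=
    h.continuous_angular.comp (by fun_prop : Continuous fun θ => (ρ, θ))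
  have d0 := continuous_highPart c0
  have d1 := continuous_highPart c1
  have hw := wirtinger_highPart (h.hasDerivAt_angular ρ) (by fun_prop) (h.periodic ρ)
  simp_rw [mul_pow] at hw
  rw [intervalIntegral.integral_const_mul] at hw
  have h1 : (4 * sin ρ * (∫ θ in 0..2 * π, highPart (G ρ) θ ^ 2)
        + 4 * cos ρ * ∫ θ in 0..2 * π, highPart (G ρ) θ * highPart (Gρ ρ) θ)
      ≤ sin ρ * (∫ θ in 0..2 * π, highPart (Gρ ρ) θ ^ 2)
        + 4 / sin ρ * ∫ θ in 0..2 * π, highPart (G ρ) θ ^ 2 := by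
    simp only [← intervalIntegral.integral_const_mul]
    rw [← intervalIntegral.integral_add, ← intervalIntegral.integral_add]
    · refine intervalIntegral.integral_mono_on two_pi_pos.le ?_ ?_ fun θ _ =>
        (mode_high_le _ _ hs).trans_eq (by ring)
      all_goals exact Continuous.intervalIntegrable (by fun_prop) _ _
    all_goals exact Continuous.intervalIntegrable (by fun_prop) _ _
  rw [intervalIntegral.integral_add, integral_sq_eq_modes c1]
  · have h2 := mul_le_mul_of_nonneg_left (modeOneBound_le k (fun ρ => cosMode (G ρ))
      (fun ρ => cosMode (Gρ ρ)) hs hc) pi_pos.le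
    have h3 := mul_le_mul_of_nonneg_left (modeOneBound_le l (fun ρ => sinMode (G ρ))
      (fun ρ => sinMode (Gρ ρ)) hs hc) pi_pos.le
    have h4 := div_le_div_of_nonneg_right hw hs.le
    have h5 : sin ρ ^ 2 * (∫ θ in 0..2 * π, η ρ θ ^ 2) / sin ρ
        = sin ρ * ∫ θ in 0..2 * π, η ρ θ ^ 2 := by field_simp
    have h6 : (π * cosMode (G ρ) ^ 2 + π * sinMode (G ρ) ^ 2
        + 4 * ∫ θ in 0..2 * π, highPart (G ρ) θ ^ 2) / sin ρ
      = π * (cosMode (G ρ) ^ 2 / sin ρ) + π * (sinMode (G ρ) ^ 2 / sin ρ)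
        + 4 / sin ρ * ∫ θ in 0..2 * π, highPart (G ρ) θ ^ 2 := by ring
    rw [h5, h6] at h4
    linarith
  all_goals exact Continuous.intervalIntegrable (by fun_prop) _ _

/-- The three orthogonality conditions decouple into one for each of the low modes. The constants
are `11/10` for the mean and `9/8` for order one; for the high part they are `3` in the interior and
`2` on the boundary. The smallest is `11/10`. -/
theorem IsPolarSmooth.gap {G Gρ η : ℝ → ℝ → ℝ} (h : IsPolarSmooth G Gρ η) {A : ℝ} (hA : 0 < A)
    (hA' : A ≤ π / 2)
    (hmean : 2 * (∫ ρ in 0..A, sin ρ * ∫ θ in 0..2 * π, G ρ θ)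
      + cos A * (∫ θ in 0..2 * π, G A θ) = 0)
    (hcos : 2 * (∫ ρ in 0..A, sin ρ * ∫ θ in 0..2 * π, G ρ θ * (sin ρ * cos θ))
      + cos A * (∫ θ in 0..2 * π, G A θ * (sin A * cos θ)) = 0)
    (hsin : 2 * (∫ ρ in 0..A, sin ρ * ∫ θ in 0..2 * π, G ρ θ * (sin ρ * sin θ))
      + cos A * (∫ θ in 0..2 * π, G A θ * (sin A * sin θ)) = 0) :
    11 / 10 * (2 * (∫ ρ in 0..A, sin ρ * ∫ θ in 0..2 * π, G ρ θ ^ 2)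
      + cos A * (∫ θ in 0..2 * π, G A θ ^ 2))
    ≤ ∫ ρ in 0..A, sin ρ * ∫ θ in 0..2 * π, (Gρ ρ θ ^ 2 + η ρ θ ^ 2) := by
  have hc : ∀ ρ, Continuous (G ρ) := fun ρ =>
    h.continuous.comp (by fun_prop : Continuous fun θ => (ρ, θ))
  have hcA : 0 ≤ cos A := cos_nonneg_of_neg_pi_div_two_le_of_le (by linarith) hA'
  set f : ℝ → ℝ := fun ρ => meanMode (G ρ) with hf
  set f' : ℝ → ℝ := fun ρ => meanMode (Gρ ρ) with hf'
  set a : ℝ → ℝ := fun ρ => cosMode (G ρ) with ha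
  set a' : ℝ → ℝ := fun ρ => cosMode (Gρ ρ) with ha'
  set b : ℝ → ℝ := fun ρ => sinMode (G ρ) with hb
  set b' : ℝ → ℝ := fun ρ => sinMode (Gρ ρ) with hb'
  set P : ℝ → ℝ := fun ρ => ∫ θ in 0..2 * π, highPart (G ρ) θ ^ 2 with hP
  set Q : ℝ → ℝ := fun ρ => ∫ θ in 0..2 * π, highPart (G ρ) θ * highPart (Gρ ρ) θ with hQ
  have df : ∀ ρ, HasDerivAt f (f' ρ) ρ :=
    hasDerivAt_meanMode h.continuous h.continuous_radial h.hasDerivAt_radial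
  have da : ∀ ρ, HasDerivAt a (a' ρ) ρ :=
    hasDerivAt_cosMode h.continuous h.continuous_radial h.hasDerivAt_radial
  have db : ∀ ρ, HasDerivAt b (b' ρ) ρ :=
    hasDerivAt_sinMode h.continuous h.continuous_radial h.hasDerivAt_radial
  have dP : ∀ ρ, HasDerivAt P (2 * Q ρ) ρ :=
    hasDerivAt_integral_highPart_sq h.continuous h.continuous_radial h.hasDerivAt_radial
  have cf : Continuous f := continuous_meanMode h.continuous
  have cf' : Continuous f' := continuous_meanMode h.continuous_radial
  have ca : Continuous a := continuous_cosMode h.continuous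
  have ca' : Continuous a' := continuous_cosMode h.continuous_radial
  have cb : Continuous b := continuous_sinMode h.continuous
  have cb' : Continuous b' := continuous_sinMode h.continuous_radial
  have cP : Continuous P := continuous_integral_circle (F := fun ρ θ => highPart (G ρ) θ ^ 2)
    (by simpa using! (continuous_uncurry_highPart h.continuous).pow 2)
  have cQ : Continuous Q := continuous_integral_circle
    (F := fun ρ θ => highPart (G ρ) θ * highPart (Gρ ρ) θ)
    ((continuous_uncurry_highPart h.continuous).mul
      (continuous_uncurry_highPart h.continuous_radial))
  have cE : Continuous fun ρ => ∫ θ in 0..2 * π, (Gρ ρ θ ^ 2 + η ρ θ ^ 2) :=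
    continuous_integral_circle (F := fun ρ θ => Gρ ρ θ ^ 2 + η ρ θ ^ 2)
      ((h.continuous_radial.pow 2).add (h.continuous_angular.pow 2))
  have hpole : G 0 = fun _ => G 0 0 := funext h.pole
  have a0 : a 0 = 0 := by simp only [ha]; rw [hpole]; simp [cosMode]
  have b0 : b 0 = 0 := by simp only [hb]; rw [hpole]; simp [sinMode]
  -- At the pole `G` does not depend on `θ`, so only the mean survives; this kills the boundary term
  -- at `ρ = 0` in `h3`.
  have P0 : P 0 = 0 := by
    have : highPart (G 0) = fun _ => 0 := by
      funext θ
      have e1 : cosMode (G 0) = 0 := a0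
      have e2 : sinMode (G 0) = 0 := b0
      rw [highPart, e1, e2, meanMode, hpole]
      simp; field_simp; simp
    simp only [hP, this]; simp
  have h0 := mode_zero_gap df cf' hA.le hA' (by
    simp_rw [integral_eq_meanMode] at hmean
    have e : ∀ ρ, sin ρ * (2 * π * meanMode (G ρ)) = 2 * π * (sin ρ * f ρ) := fun ρ => by
      simp only [hf]; ring
    simp_rw [e] at hmean
    rw [intervalIntegral.integral_const_mul] at hmean
    have : 2 * π * (2 * (∫ ρ in 0..A, sin ρ * f ρ) + cos A * f A) = 0 := by
      simp only [hf] at hmean ⊢; linarith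
    exact (mul_eq_zero.1 this).resolve_left two_pi_pos.ne')
  have h1 := mode_one_gap da ca' hA hA' a0 (by
    have e1 : ∀ ρ, ∫ θ in 0..2 * π, G ρ θ * (sin ρ * cos θ) = sin ρ * (π * a ρ) := fun ρ => by
      simp only [ha, ← integral_mul_cos_eq, ← intervalIntegral.integral_const_mul]
      congr 1; funext θ; ring
    simp_rw [e1] at hcos
    have e : ∀ ρ, sin ρ * (sin ρ * (π * a ρ)) = π * (sin ρ ^ 2 * a ρ) := fun ρ => by ring
    simp_rw [e] at hcos
    rw [intervalIntegral.integral_const_mul] at hcos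
    have : π * (2 * (∫ ρ in 0..A, sin ρ ^ 2 * a ρ) + cos A * sin A * a A) = 0 := by linarith
    exact (mul_eq_zero.1 this).resolve_left pi_ne_zero)
  have h2 := mode_one_gap db cb' hA hA' b0 (by
    have e1 : ∀ ρ, ∫ θ in 0..2 * π, G ρ θ * (sin ρ * sin θ) = sin ρ * (π * b ρ) := fun ρ => by
      simp only [hb, ← integral_mul_sin_eq, ← intervalIntegral.integral_const_mul]
      congr 1; funext θ; ring
    simp_rw [e1] at hsin
    have e : ∀ ρ, sin ρ * (sin ρ * (π * b ρ)) = π * (sin ρ ^ 2 * b ρ) := fun ρ => by ring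
    simp_rw [e] at hsin
    rw [intervalIntegral.integral_const_mul] at hsin
    have : π * (2 * (∫ ρ in 0..A, sin ρ ^ 2 * b ρ) + cos A * sin A * b A) = 0 := by linarith
    exact (mul_eq_zero.1 this).resolve_left pi_ne_zero)
  -- Since `P' = 2 Q`, the integrand is `6 sin · P` plus the derivative of `2 cos · P`.
  have h3 : ∫ ρ in 0..A, (4 * sin ρ * P ρ + 4 * cos ρ * Q ρ)
      = 6 * (∫ ρ in 0..A, sin ρ * P ρ) + 2 * (cos A * P A) := by
    have hd : ∀ ρ, HasDerivAt (fun ρ => 2 * (cos ρ * P ρ))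
        (2 * (-sin ρ * P ρ + cos ρ * (2 * Q ρ))) ρ := fun ρ =>
      ((hasDerivAt_cos ρ).mul (dP ρ)).const_mul 2
    have := intervalIntegral.integral_eq_sub_of_hasDerivAt (a := 0) (b := A) (fun x _ => hd x)
      (Continuous.intervalIntegrable (by fun_prop) _ _)
    rw [P0] at this
    rw [show 2 * (cos A * P A) = ∫ ρ in 0..A, 2 * (-sin ρ * P ρ + cos ρ * (2 * Q ρ)) by
      rw [this]; ring, ← intervalIntegral.integral_const_mul, ← intervalIntegral.integral_add]
    · congr 1; funext ρ; ring
    all_goals exact Continuous.intervalIntegrable (by fun_prop) _ _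
  have hPnn : ∀ ρ, 0 ≤ P ρ := fun ρ =>
    intervalIntegral.integral_nonneg two_pi_pos.le fun θ _ => sq_nonneg _
  have hPI : 0 ≤ ∫ ρ in 0..A, sin ρ * P ρ :=
    intervalIntegral.integral_nonneg hA.le fun ρ hρ =>
      mul_nonneg (sin_nonneg_of_nonneg_of_le_pi hρ.1 (by linarith [pi_pos, hρ.2])) (hPnn ρ)
  have hNa : 0 ≤ 2 * (∫ ρ in 0..A, sin ρ * a ρ ^ 2) + cos A * a A ^ 2 := by
    have : 0 ≤ ∫ ρ in 0..A, sin ρ * a ρ ^ 2 :=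
      intervalIntegral.integral_nonneg hA.le fun ρ hρ =>
        mul_nonneg (sin_nonneg_of_nonneg_of_le_pi hρ.1 (by linarith [pi_pos, hρ.2])) (sq_nonneg _)
    positivity
  have hNb : 0 ≤ 2 * (∫ ρ in 0..A, sin ρ * b ρ ^ 2) + cos A * b A ^ 2 := by
    have : 0 ≤ ∫ ρ in 0..A, sin ρ * b ρ ^ 2 :=
      intervalIntegral.integral_nonneg hA.le fun ρ hρ =>
        mul_nonneg (sin_nonneg_of_nonneg_of_le_pi hρ.1 (by linarith [pi_pos, hρ.2])) (sq_nonneg _)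
    positivity
  have cm1 := continuous_modeOneBound ca ca' (a A / sin A)
  have cm2 := continuous_modeOneBound cb cb' (b A / sin A)
  -- The pointwise estimate needs `sin ρ > 0`, hence the open interval; both integrands are
  -- continuous up to `ρ = 0`, so integrability is automatic.
  have hlow : ∫ ρ in 0..A, (2 * π * (sin ρ * f' ρ ^ 2) + π * modeOneBound (a A / sin A) a a' ρ
      + π * modeOneBound (b A / sin A) b b' ρ + (4 * sin ρ * P ρ + 4 * cos ρ * Q ρ))
      ≤ ∫ ρ in 0..A, sin ρ * ∫ θ in 0..2 * π, (Gρ ρ θ ^ 2 + η ρ θ ^ 2) := by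
    refine intervalIntegral.integral_mono_on_of_le_Ioo hA.le
      (Continuous.intervalIntegrable (by fun_prop) _ _)
      (Continuous.intervalIntegrable (by fun_prop) _ _) fun ρ hρ => ?_
    exact h.energy_density_ge _ _ (sin_pos_of_pos_of_lt_pi hρ.1 (by linarith [pi_pos, hρ.2]))
      (cos_nonneg_of_neg_pi_div_two_le_of_le (by linarith [pi_pos, hρ.1]) (by linarith [hρ.2]))
  rw [intervalIntegral.integral_add, intervalIntegral.integral_add, intervalIntegral.integral_add,
    h3] at hlow
  · simp only [intervalIntegral.integral_const_mul] at hlow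
    have hN : ∫ ρ in 0..A, sin ρ * ∫ θ in 0..2 * π, G ρ θ ^ 2
        = 2 * π * (∫ ρ in 0..A, sin ρ * f ρ ^ 2) + π * (∫ ρ in 0..A, sin ρ * a ρ ^ 2)
          + π * (∫ ρ in 0..A, sin ρ * b ρ ^ 2) + ∫ ρ in 0..A, sin ρ * P ρ := by
      rw [← intervalIntegral.integral_const_mul, ← intervalIntegral.integral_const_mul,
        ← intervalIntegral.integral_const_mul, ← intervalIntegral.integral_add,
        ← intervalIntegral.integral_add, ← intervalIntegral.integral_add]
      · congr 1; funext ρ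
        rw [integral_sq_eq_modes (hc ρ)]
        simp only [hf, ha, hb, hP]
        ring
      all_goals exact Continuous.intervalIntegrable (by fun_prop) _ _
    have hNA : ∫ θ in 0..2 * π, G A θ ^ 2
        = 2 * π * f A ^ 2 + π * a A ^ 2 + π * b A ^ 2 + P A := integral_sq_eq_modes (hc A)
    rw [hN, hNA]
    have e0 := mul_le_mul_of_nonneg_left h0 two_pi_pos.le
    have e1 := mul_le_mul_of_nonneg_left h1 pi_pos.le
    have e2 := mul_le_mul_of_nonneg_left h2 pi_pos.le
    have e3 := mul_nonneg hcA (hPnn A)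
    have e4 := mul_nonneg pi_pos.le hNa
    have e5 := mul_nonneg pi_pos.le hNb
    linarith
  all_goals exact Continuous.intervalIntegrable (by fun_prop) _ _

/-- This is the weak equation for `sin ρ · w θ`. Integrating by parts in `θ` with `w'' = -w` turns
the angular term into `a = ∫ w G`. Since `1 = (cos² - sin²) + 2 sin²`, the integrand becomes `(sin
cos · a)' + 2 sin² · a`, and the total derivative produces the boundary integral. -/
theorem IsPolarSmooth.weak_mode_one {G Gρ η : ℝ → ℝ → ℝ} (h : IsPolarSmooth G Gρ η) (A : ℝ)
    {w w' : ℝ → ℝ} (hw : ∀ θ, HasDerivAt w (w' θ) θ) (hw' : ∀ θ, HasDerivAt w' (-w θ) θ)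
    (hwp : w' (2 * π) = w' 0) :
    ∫ ρ in 0..A, sin ρ * ∫ θ in 0..2 * π, (cos ρ * w θ * Gρ ρ θ + w' θ * η ρ θ)
      = 2 * (∫ ρ in 0..A, sin ρ * ∫ θ in 0..2 * π, sin ρ * w θ * G ρ θ)
        + cos A * ∫ θ in 0..2 * π, sin A * w θ * G A θ := by
  have cw : Continuous w := continuous_iff_continuousAt.2 fun t => (hw t).continuousAt
  have cw' : Continuous w' := continuous_iff_continuousAt.2 fun t => (hw' t).continuousAt
  have cw2 : Continuous fun p : ℝ × ℝ => w p.2 := cw.comp continuous_snd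
  set a : ℝ → ℝ := fun ρ => ∫ θ in 0..2 * π, w θ * G ρ θ with ha
  set a' : ℝ → ℝ := fun ρ => ∫ θ in 0..2 * π, w θ * Gρ ρ θ with ha'
  have ca : Continuous a := continuous_integral_circle (F := fun ρ θ => w θ * G ρ θ)
    (cw2.mul h.continuous)
  have ca' : Continuous a' := continuous_integral_circle (F := fun ρ θ => w θ * Gρ ρ θ)
    (cw2.mul h.continuous_radial)
  have da : ∀ ρ, HasDerivAt a (a' ρ) ρ := hasDerivAt_integral_circle
    (F := fun ρ θ => w θ * G ρ θ) (F' := fun ρ θ => w θ * Gρ ρ θ)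
    (cw2.mul h.continuous) (cw2.mul h.continuous_radial)
    (fun ρ θ => (h.hasDerivAt_radial ρ θ).const_mul _)
  have e1 : ∀ ρ, sin ρ * ∫ θ in 0..2 * π, (cos ρ * w θ * Gρ ρ θ + w' θ * η ρ θ)
      = ((cos ρ * cos ρ + sin ρ * -sin ρ) * a ρ + sin ρ * cos ρ * a' ρ)
        + 2 * (sin ρ * (sin ρ * a ρ)) := by
    intro ρ
    have c1 : Continuous (Gρ ρ) :=
      h.continuous_radial.comp (by fun_prop : Continuous fun θ => (ρ, θ))
    have c2 : Continuous (η ρ) :=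
      h.continuous_angular.comp (by fun_prop : Continuous fun θ => (ρ, θ))
    have i1 := integral_deriv_mul_periodic (h.hasDerivAt_angular ρ) (by fun_prop) hw'
      (by fun_prop) (h.periodic ρ) hwp
    have i2 : ∫ θ in 0..2 * π, G ρ θ * -w θ = -a ρ := by
      simp only [ha, ← intervalIntegral.integral_neg]
      congr 1; funext θ; ring
    have i3 : ∫ θ in 0..2 * π, sin ρ * η ρ θ * w' θ = sin ρ * ∫ θ in 0..2 * π, w' θ * η ρ θ := by
      rw [← intervalIntegral.integral_const_mul]
      congr 1; funext θ; ring
    have i4 : ∫ θ in 0..2 * π, cos ρ * w θ * Gρ ρ θ = cos ρ * a' ρ := by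
      simp only [ha', ← intervalIntegral.integral_const_mul]
      congr 1; funext θ; ring
    rw [intervalIntegral.integral_add, i4, mul_add, ← i3, i1, i2]
    · have := sin_sq_add_cos_sq ρ
      linear_combination (-a ρ) * this
    all_goals exact Continuous.intervalIntegrable (by fun_prop) _ _
  have e2 : ∀ ρ, ∫ θ in 0..2 * π, sin ρ * w θ * G ρ θ = sin ρ * a ρ := by
    intro ρ
    simp only [ha, ← intervalIntegral.integral_const_mul]
    congr 1; funext θ; ring
  have hd : ∀ ρ, HasDerivAt (fun ρ => sin ρ * cos ρ * a ρ)
      ((cos ρ * cos ρ + sin ρ * -sin ρ) * a ρ + sin ρ * cos ρ * a' ρ) ρ := fun ρ =>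
    ((hasDerivAt_sin ρ).mul (hasDerivAt_cos ρ)).mul (da ρ)
  simp_rw [e1, e2]
  rw [intervalIntegral.integral_add,
    intervalIntegral.integral_eq_sub_of_hasDerivAt (fun ρ _ => hd ρ),
    intervalIntegral.integral_const_mul]
  · simp; ring
  all_goals exact Continuous.intervalIntegrable (by fun_prop) _ _

/-! ### Spherical coordinates -/

/-- The point of the unit sphere with polar angle `ρ` and azimuth `θ`. -/
noncomputable def sph (ρ θ : ℝ) : E3 := !₂[sin ρ * cos θ, sin ρ * sin θ, cos ρ]

theorem continuous_sph : Continuous fun p : ℝ × ℝ => sph p.1 p.2 := by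
  unfold sph; fun_prop

theorem norm_sph (ρ θ : ℝ) : ‖sph ρ θ‖ = 1 := by
  rw [EuclideanSpace.norm_eq, Real.sqrt_eq_one]
  simp only [sph, Fin.sum_univ_three, Real.norm_eq_abs, sq_abs, Matrix.cons_val]
  linear_combination (sin ρ ^ 2) * sin_sq_add_cos_sq θ + sin_sq_add_cos_sq ρ

theorem measurePreserving_cylinder :
    MeasurePreserving (fun x : E3 => (x 2, (x 0, x 1))) volume volume := by
  have h1 := EuclideanSpace.volume_preserving_symm_measurableEquiv_toLp (Fin 3)
  have h2 := volume_preserving_piFinSuccAbove (fun _ : Fin 3 => ℝ) 2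
  have h3 : MeasurePreserving (Prod.map (id : ℝ → ℝ)
      (MeasurableEquiv.finTwoArrow (α := ℝ))) volume volume :=
    (MeasurePreserving.id volume).prod (volume_preserving_finTwoArrow ℝ)
  exact (h3.comp h2).comp h1

theorem lintegral_cylinder {F : E3 → ℝ≥0∞} (hF : Measurable F) :
    ∫⁻ x, F x = ∫⁻ z : ℝ, ∫⁻ p : ℝ × ℝ, F !₂[p.1, p.2, z] := by
  have hm : Measurable fun q : ℝ × ℝ × ℝ => F !₂[q.2.1, q.2.2, q.1] :=
    hF.comp (Continuous.measurable (by fun_prop))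
  rw [← lintegral_prod (μ := volume) (ν := volume)
    (fun q : ℝ × ℝ × ℝ => F !₂[q.2.1, q.2.2, q.1]) hm.aemeasurable,
    ← Measure.volume_eq_prod, ← measurePreserving_cylinder.lintegral_comp hm]
  congr 1; funext x; congr 1
  ext i; fin_cases i <;> rfl

theorem lintegral_polar {f : ℝ × ℝ → ℝ≥0∞} (hf : Measurable f) :
    ∫⁻ p, f p = ∫⁻ θ in Set.Ioo (-π) π, ∫⁻ r in Set.Ioi 0,
      ENNReal.ofReal r * f (r * cos θ, r * sin θ) := by
  rw [← lintegral_comp_polarCoord_symm, polarCoord_target, Measure.volume_eq_prod,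
    ← Measure.prod_restrict, lintegral_prod_symm']
  · simp [polarCoord_symm_apply]
  · simp only [polarCoord_symm_apply, smul_eq_mul]
    exact Measurable.mul (by fun_prop) (hf.comp (by fun_prop))

/-- Planar polar coordinates are used twice: in `(x₀, x₁)`, giving the distance `s` to the axis and
`θ`, and then in the half-plane of `(z, s)`, giving `r` and `ρ`. The two Jacobians `s = r sin ρ` and
`r` multiply to `r² sin ρ`. -/
theorem lintegral_spherical {F : E3 → ℝ≥0∞} (hF : Measurable F) :
    ∫⁻ x, F x = ∫⁻ θ in Set.Ioo (-π) π, ∫⁻ ρ in Set.Ioo 0 π, ∫⁻ r in Set.Ioi 0,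
      ENNReal.ofReal (r ^ 2 * sin ρ) * F (r • sph ρ θ) := by
  have hm : Measurable fun q : (ℝ × ℝ) × ℝ =>
      ENNReal.ofReal q.1.2 * F !₂[q.1.2 * cos q.2, q.1.2 * sin q.2, q.1.1] :=
    Measurable.mul (by fun_prop) (hF.comp (Continuous.measurable (by fun_prop)))
  rw [lintegral_cylinder hF]
  have h1 : ∀ z : ℝ, ∫⁻ p : ℝ × ℝ, F !₂[p.1, p.2, z] = ∫⁻ θ in Set.Ioo (-π) π,
      ∫⁻ s in Set.Ioi 0, ENNReal.ofReal s * F !₂[s * cos θ, s * sin θ, z] := fun z =>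
    lintegral_polar (f := fun p => F !₂[p.1, p.2, z])
      (hF.comp (Continuous.measurable (by fun_prop)))
  simp_rw [h1]
  rw [lintegral_lintegral_swap]
  swap
  · exact (Measurable.lintegral_prod_right' (f := fun q : (ℝ × ℝ) × ℝ =>
      ENNReal.ofReal q.2 * F !₂[q.2 * cos q.1.2, q.2 * sin q.1.2, q.1.1])
      (hm.comp (by fun_prop : Measurable fun q : (ℝ × ℝ) × ℝ => ((q.1.1, q.2), q.1.2)))).aemeasurable
  refine setLIntegral_congr_fun measurableSet_Ioo fun θ _ => ?_
  -- Extension by zero to `s ≤ 0` makes the planar formula applicable; the angles `ρ ≤ 0` then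
  -- contribute nothing.
  set H : ℝ × ℝ → ℝ≥0∞ := (Set.univ ×ˢ Set.Ioi 0).indicator fun q =>
    ENNReal.ofReal q.2 * F !₂[q.2 * cos θ, q.2 * sin θ, q.1] with hH
  have hHm : Measurable H := Measurable.indicator
    (hm.comp (by fun_prop : Measurable fun q : ℝ × ℝ => (q, θ)))
    (MeasurableSet.univ.prod measurableSet_Ioi)
  have h2 : ∫⁻ z : ℝ, ∫⁻ s in Set.Ioi 0, ENNReal.ofReal s * F !₂[s * cos θ, s * sin θ, z]
      = ∫⁻ q, H q := by
    rw [Measure.volume_eq_prod, lintegral_prod _ hHm.aemeasurable]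
    congr 1; funext z
    rw [← lintegral_indicator measurableSet_Ioi]
    congr 1; funext s
    by_cases hs : 0 < s <;> simp [hH, hs, Set.indicator]
  rw [h2, lintegral_polar hHm, ← lintegral_indicator measurableSet_Ioo,
    ← lintegral_indicator measurableSet_Ioo]
  congr 1; funext ρ
  by_cases hρ : ρ ∈ Set.Ioo 0 π
  · have hρ' : ρ ∈ Set.Ioo (-π) π := ⟨by linarith [hρ.1, pi_pos], hρ.2⟩
    rw [Set.indicator_of_mem hρ, Set.indicator_of_mem hρ']
    refine setLIntegral_congr_fun measurableSet_Ioi fun r hr => ?_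
    have hr : 0 < r := hr
    have hs := sin_pos_of_pos_of_lt_pi hρ.1 hρ.2
    have hrs : (r * cos ρ, r * sin ρ) ∈ (Set.univ ×ˢ Set.Ioi 0 : Set (ℝ × ℝ)) :=
      ⟨trivial, mul_pos hr hs⟩
    simp only [hH]
    rw [Set.indicator_of_mem hrs, ← mul_assoc, ← ENNReal.ofReal_mul hr.le]
    congr 2
    · ring
    · ext i; fin_cases i <;> simp [sph] <;> ring
  · rw [Set.indicator_of_notMem hρ]
    by_cases hρ' : ρ ∈ Set.Ioo (-π) π
    · rw [Set.indicator_of_mem hρ', ← lintegral_zero (μ := volume.restrict (Set.Ioi (0 : ℝ)))]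
      refine setLIntegral_congr_fun measurableSet_Ioi fun r hr => ?_
      have hρ0 : ρ ≤ 0 := by
        by_contra! h
        exact hρ ⟨h, hρ'.2⟩
      have hs : sin ρ ≤ 0 := sin_nonpos_of_nonpos_of_neg_pi_le hρ0 hρ'.1.le
      have hr : 0 < r := hr
      have hrs : (r * cos ρ, r * sin ρ) ∉ (Set.univ ×ˢ Set.Ioi 0 : Set (ℝ × ℝ)) := by
        rintro ⟨-, h⟩
        exact absurd (show 0 < r * sin ρ from h) (not_lt.2 (mul_nonpos_of_nonneg_of_nonpos hr.le hs))
      simp only [hH]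
      rw [Set.indicator_of_notMem hrs, mul_zero]
    · rw [Set.indicator_of_notMem hρ']

/-- The open cone of height one over a subset of the unit sphere. -/
def unitCone (S : Set E3) : Set E3 := {x | 0 < ‖x‖ ∧ ‖x‖ < 1 ∧ ‖x‖⁻¹ • x ∈ S}

theorem measurableSet_unitCone {S : Set E3} (hS : MeasurableSet S) :
    MeasurableSet (unitCone S) := by
  refine (measurableSet_lt measurable_const measurable_norm).inter
    ((measurableSet_lt measurable_norm measurable_const).inter ?_)
  exact (by fun_prop : Measurable fun x : E3 => ‖x‖⁻¹ • x) hS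

theorem smul_sph_mem_unitCone {S : Set E3} {r : ℝ} (hr : 0 < r) (ρ θ : ℝ) :
    r • sph ρ θ ∈ unitCone S ↔ r < 1 ∧ sph ρ θ ∈ S := by
  simp only [unitCone, Set.mem_ofPred_eq, norm_smul, norm_sph, mul_one, Real.norm_eq_abs,
    abs_of_pos hr, smul_smul, inv_mul_cancel₀ hr.ne', one_smul, hr, true_and]

open scoped Pointwise in
theorem Ioo_smul_eq_unitCone (S : Set E3) :
    Set.Ioo (0 : ℝ) 1 • (Subtype.val '' (Subtype.val ⁻¹' S : Set (Metric.sphere (0 : E3) 1)))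
      = unitCone S := by
  ext x
  simp only [unitCone, Set.mem_smul, Set.mem_image, Set.mem_preimage, Set.mem_ofPred_eq]
  constructor
  · rintro ⟨r, hr, -, ⟨y, hy, rfl⟩, rfl⟩
    have hn : ‖(y : E3)‖ = 1 := by simp
    rw [norm_smul, hn, mul_one, Real.norm_eq_abs, abs_of_pos hr.1, smul_smul,
      inv_mul_cancel₀ hr.1.ne', one_smul]
    exact ⟨hr.1, hr.2, hy⟩
  · rintro ⟨h0, h1, h2⟩
    refine ⟨‖x‖, ⟨h0, h1⟩, ‖x‖⁻¹ • x, ⟨⟨‖x‖⁻¹ • x, ?_⟩, h2, rfl⟩, ?_⟩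
    · simp [norm_smul, h0.ne']
    · rw [smul_smul, mul_inv_cancel₀ h0.ne', one_smul]

theorem lintegral_sq_Ioo : ∫⁻ r in Set.Ioo (0 : ℝ) 1, ENNReal.ofReal (r ^ 2)
    = ENNReal.ofReal (1 / 3) := by
  rw [← ofReal_integral_eq_lintegral_ofReal, ← integral_Ioc_eq_integral_Ioo,
    ← intervalIntegral.integral_of_le zero_le_one]
  · congr 1; rw [integral_pow]; norm_num
  · exact (Continuous.integrableOn_Icc (by fun_prop)).mono_set Set.Ioo_subset_Icc_self
  · exact .of_forall fun r => sq_nonneg r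

theorem lintegral_radius_unitCone (S : Set E3) (ρ θ : ℝ) : ∫⁻ r in Set.Ioi 0,
      ENNReal.ofReal (r ^ 2 * sin ρ) * (unitCone S).indicator 1 (r • sph ρ θ)
      = ENNReal.ofReal (1 / 3) * (ENNReal.ofReal (sin ρ) * S.indicator 1 (sph ρ θ)) := by
  rw [← lintegral_sq_Ioo, ← lintegral_mul_const _ (by fun_prop),
    ← lintegral_indicator measurableSet_Ioi, ← lintegral_indicator measurableSet_Ioo]
  congr 1; funext r
  by_cases hr : 0 < r
  · have hmem := smul_sph_mem_unitCone (S := S) hr ρ θ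
    rw [Set.indicator_of_mem (show r ∈ Set.Ioi 0 from hr)]
    by_cases hr1 : r < 1
    · rw [Set.indicator_of_mem (show r ∈ Set.Ioo 0 1 from ⟨hr, hr1⟩),
        ENNReal.ofReal_mul (sq_nonneg r), mul_assoc]
      by_cases hS' : sph ρ θ ∈ S
      · rw [Set.indicator_of_mem hS', Set.indicator_of_mem (hmem.2 ⟨hr1, hS'⟩)]; rfl
      · rw [Set.indicator_of_notMem hS', Set.indicator_of_notMem fun h => hS' (hmem.1 h).2]
    · rw [Set.indicator_of_notMem (fun h : r ∈ Set.Ioo 0 1 => hr1 h.2),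
        Set.indicator_of_notMem (fun h => hr1 (hmem.1 h).1), mul_zero]
  · rw [Set.indicator_of_notMem (fun h : r ∈ Set.Ioi 0 => hr h),
      Set.indicator_of_notMem (fun h : r ∈ Set.Ioo 0 1 => hr h.1)]

theorem measurable_sin_mul_indicator {S : Set E3} (hS : MeasurableSet S) :
    Measurable fun p : ℝ × ℝ =>
      ENNReal.ofReal (sin p.2) * S.indicator (1 : E3 → ℝ≥0∞) (sph p.2 p.1) := by
  have hsph : Measurable fun p : ℝ × ℝ => sph p.2 p.1 :=
    (continuous_sph.comp continuous_swap).measurable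
  have hone : Measurable (S.indicator (1 : E3 → ℝ≥0∞)) := measurable_one.indicator hS
  exact Measurable.mul (by fun_prop) (hone.comp hsph)

theorem volume_unitCone {S : Set E3} (hS : MeasurableSet S) :
    volume (unitCone S) = ∫⁻ θ in Set.Ioo (-π) π, ∫⁻ ρ in Set.Ioo 0 π,
      ENNReal.ofReal (1 / 3) * (ENNReal.ofReal (sin ρ) * S.indicator 1 (sph ρ θ)) := by
  rw [← lintegral_indicator_one (measurableSet_unitCone hS),
    lintegral_spherical (measurable_one.indicator (measurableSet_unitCone hS))]
  simp_rw [lintegral_radius_unitCone]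

/-- Surface measure is by definition the dimension `3` times the volume of the cone over `S`, and
the radial integral of `r²` over `(0, 1)` contributes the compensating `1/3`. -/
theorem toSphere_map_apply {S : Set E3} (hS : MeasurableSet S) :
    ((volume : Measure E3).toSphere.map Subtype.val) S
      = ∫⁻ θ in Set.Ioo (-π) π, ∫⁻ ρ in Set.Ioo 0 π,
        ENNReal.ofReal (sin ρ) * S.indicator 1 (sph ρ θ) := by
  have hdim : (Module.finrank ℝ E3 : ℝ≥0∞) * ENNReal.ofReal (1 / 3) = 1 := by
    rw [finrank_euclideanSpace_fin, show ((3 : ℕ) : ℝ≥0∞) = ENNReal.ofReal 3 by simp,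
      ← ENNReal.ofReal_mul (by norm_num)]
    norm_num
  have hind := measurable_sin_mul_indicator hS
  have h1 : ∫⁻ θ in Set.Ioo (-π) π, ∫⁻ ρ in Set.Ioo 0 π, ENNReal.ofReal (1 / 3)
      * (ENNReal.ofReal (sin ρ) * S.indicator 1 (sph ρ θ))
      = ENNReal.ofReal (1 / 3) * ∫⁻ θ in Set.Ioo (-π) π, ∫⁻ ρ in Set.Ioo 0 π,
        ENNReal.ofReal (sin ρ) * S.indicator 1 (sph ρ θ) := by
    rw [← lintegral_const_mul (ENNReal.ofReal (1 / 3)) (Measurable.lintegral_prod_right' hind)]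
    congr 1; funext θ
    have hθ : Measurable fun ρ => ENNReal.ofReal (sin ρ) * S.indicator (1 : E3 → ℝ≥0∞) (sph ρ θ) :=
      hind.comp (g := fun p : ℝ × ℝ => ENNReal.ofReal (sin p.2) * S.indicator 1 (sph p.2 p.1))
        (f := fun ρ : ℝ => (θ, ρ)) (by fun_prop)
    exact lintegral_const_mul (ENNReal.ofReal (1 / 3)) hθ
  rw [Measure.map_apply measurable_subtype_coe hS,
    Measure.toSphere_apply' _ (measurable_subtype_coe hS), Ioo_smul_eq_unitCone,
    volume_unitCone hS, h1, ← mul_assoc, hdim, one_mul]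

/-! ### The cap in spherical coordinates -/

/-- The polar angle of the boundary circle of the cap. -/
noncomputable def capAngle (R : ℝ) : ℝ := arccos (capHeight R)

section Angle

variable {R : ℝ}

theorem capHeight_nonneg (hR0 : 0 < R) (hR1 : R ≤ 1) : 0 ≤ capHeight R :=
  div_nonneg (by nlinarith) (by positivity)

theorem capHeight_lt_one (hR0 : 0 < R) : capHeight R < 1 := by
  rw [capHeight, div_lt_one (by positivity)]; nlinarith

theorem capRadius_pos (hR0 : 0 < R) : 0 < capRadius R := by unfold capRadius; positivity

theorem capHeight_sq_add_capRadius_sq (R : ℝ) : capHeight R ^ 2 + capRadius R ^ 2 = 1 := by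
  have h : (1 + R ^ 2) ≠ 0 := by positivity
  unfold capHeight capRadius; field_simp; ring

theorem boundaryCurvature_mul_capRadius (hR0 : 0 < R) :
    boundaryCurvature R * capRadius R = capHeight R := by
  have h : (1 + R ^ 2) ≠ 0 := by positivity
  unfold boundaryCurvature capRadius capHeight; field_simp

theorem boundaryCurvature_nonneg (hR0 : 0 < R) (hR1 : R ≤ 1) : 0 ≤ boundaryCurvature R :=
  div_nonneg (by nlinarith) (by positivity)

theorem cos_capAngle (hR0 : 0 < R) (hR1 : R ≤ 1) : cos (capAngle R) = capHeight R :=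
  cos_arccos (by linarith [capHeight_nonneg hR0 hR1]) (capHeight_lt_one hR0).le

theorem sin_capAngle (hR0 : 0 < R) : sin (capAngle R) = capRadius R := by
  rw [capAngle, sin_arccos, ← capHeight_sq_add_capRadius_sq R, add_sub_cancel_left,
    sqrt_sq (capRadius_pos hR0).le]

theorem capAngle_pos (hR0 : 0 < R) : 0 < capAngle R := arccos_pos.2 (capHeight_lt_one hR0)

theorem capAngle_le (hR0 : 0 < R) (hR1 : R ≤ 1) : capAngle R ≤ π / 2 :=
  arccos_le_pi_div_two.2 (capHeight_nonneg hR0 hR1)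

end Angle

theorem norm_sq_E2 (y : E2) : ‖y‖ ^ 2 = y 0 ^ 2 + y 1 ^ 2 := by
  rw [EuclideanSpace.norm_sq_eq]; simp [Fin.sum_univ_two]

theorem norm_sq_E3 (x : E3) : ‖x‖ ^ 2 = x 0 ^ 2 + x 1 ^ 2 + x 2 ^ 2 := by
  rw [EuclideanSpace.norm_sq_eq]; simp [Fin.sum_univ_three]

theorem norm_stereoInv (y : E2) : ‖stereoInv y‖ = 1 := by
  have h : ‖stereoInv y‖ ^ 2 = 1 := by
    have h1 : (1 + ‖y‖ ^ 2) ≠ 0 := by positivity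
    have h2 := norm_sq_E2 y
    rw [norm_sq_E3]
    simp only [stereoInv, Matrix.cons_val]
    field_simp
    linear_combination (-4) * h2
  exact (pow_eq_one_iff_of_nonneg (norm_nonneg _) two_ne_zero).1 h

theorem stereoInv_apply_two (y : E2) : stereoInv y 2 = (1 - ‖y‖ ^ 2) / (1 + ‖y‖ ^ 2) := rfl

theorem mem_cap_iff {R : ℝ} (hR0 : 0 < R) {x : E3} :
    x ∈ cap R ↔ ‖x‖ = 1 ∧ capHeight R < x 2 := by
  constructor
  · rintro ⟨z, hz, rfl⟩
    refine ⟨norm_stereoInv _, ?_⟩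
    have hz : ‖z‖ < 1 := by simpa using hz
    simp only [stereoInv_apply_two, capHeight, norm_smul, Real.norm_eq_abs, abs_of_pos hR0]
    rw [div_lt_div_iff₀ (by positivity) (by positivity)]
    have : R ^ 2 * ‖z‖ ^ 2 < R ^ 2 * 1 := by
      gcongr
      nlinarith [norm_nonneg z]
    nlinarith
  · rintro ⟨hx, h⟩
    have hx2 : x 0 ^ 2 + x 1 ^ 2 + x 2 ^ 2 = 1 := by rw [← norm_sq_E3, hx]; norm_num
    have hσ : -1 < capHeight R := by
      rw [capHeight, lt_div_iff₀ (by positivity)]; linarith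
    have hd : 0 < 1 + x 2 := by linarith
    -- Stereographic projection of `x` from the south pole.
    set y : E2 := !₂[x 0 / (1 + x 2), x 1 / (1 + x 2)] with hy
    have hyn : ‖y‖ ^ 2 = (1 - x 2) / (1 + x 2) := by
      rw [norm_sq_E2]; simp only [hy, Matrix.cons_val]
      field_simp; linear_combination hx2
    refine ⟨R⁻¹ • y, ?_, ?_⟩
    · have h1 : ‖y‖ ^ 2 < R ^ 2 := by
        rw [hyn, div_lt_iff₀ hd]
        rw [capHeight, div_lt_iff₀ (by positivity)] at h
        linarith
      have h2 : ‖y‖ < R := lt_of_pow_lt_pow_left₀ 2 hR0.le h1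
      rw [mem_ball_zero_iff, norm_smul, norm_inv, Real.norm_eq_abs, abs_of_pos hR0,
        inv_mul_lt_iff₀ hR0, mul_one]
      exact h2
    · simp only [smul_smul, mul_inv_cancel₀ hR0.ne', one_smul]
      ext i
      have h3 : 1 + (1 - x 2) / (1 + x 2) = 2 / (1 + x 2) := by field_simp; ring
      fin_cases i
      · simp only [stereoInv, hyn, h3, Fin.zero_eta, Matrix.cons_val]; simp only [hy, Matrix.cons_val]
        field_simp
      · simp only [stereoInv, hyn, h3, Fin.mk_one, Matrix.cons_val]; simp only [hy, Matrix.cons_val]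
        field_simp
      · simp only [stereoInv, hyn, h3, Fin.reduceFinMk, Matrix.cons_val]; field_simp; ring

theorem measurableSet_cap {R : ℝ} (hR0 : 0 < R) : MeasurableSet (cap R) := by
  have : cap R = {x : E3 | ‖x‖ = 1} ∩ {x : E3 | capHeight R < x 2} := by
    ext x; exact mem_cap_iff hR0
  rw [this]
  exact (measurableSet_eq_fun measurable_norm measurable_const).inter
    (measurableSet_lt measurable_const (by fun_prop))

theorem sph_mem_cap_iff {R : ℝ} (hR0 : 0 < R) (hR1 : R ≤ 1) {ρ : ℝ} (hρ : ρ ∈ Set.Ioo 0 π) (θ : ℝ) :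
    sph ρ θ ∈ cap R ↔ ρ < capAngle R := by
  rw [mem_cap_iff hR0]
  simp only [norm_sph, true_and]
  rw [← cos_capAngle hR0 hR1]
  change cos (capAngle R) < cos ρ ↔ _
  exact strictAntiOn_cos.lt_iff_gt
    ⟨(capAngle_pos hR0).le, by linarith [capAngle_le hR0 hR1, pi_pos]⟩ ⟨hρ.1.le, hρ.2.le⟩

theorem areaMeasure_apply {R : ℝ} (hR0 : 0 < R) (hR1 : R ≤ 1) {S : Set E3} (hS : MeasurableSet S) :
    areaMeasure R S = ∫⁻ θ in Set.Ioo (-π) π, ∫⁻ ρ in Set.Ioo 0 (capAngle R),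
        ENNReal.ofReal (sin ρ) * S.indicator 1 (sph ρ θ) := by
  rw [areaMeasure, Measure.restrict_apply hS, toSphere_map_apply (hS.inter (measurableSet_cap hR0))]
  congr 1; funext θ
  rw [← lintegral_indicator measurableSet_Ioo, ← lintegral_indicator measurableSet_Ioo]
  congr 1; funext ρ
  have hAπ : capAngle R < π := by linarith [capAngle_le hR0 hR1, pi_pos]
  by_cases hρ : ρ ∈ Set.Ioo 0 π
  · rw [Set.indicator_of_mem hρ]
    by_cases hA : ρ < capAngle R
    · rw [Set.indicator_of_mem (show ρ ∈ Set.Ioo 0 (capAngle R) from ⟨hρ.1, hA⟩)]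
      by_cases hs : sph ρ θ ∈ S
      · rw [Set.indicator_of_mem hs,
          Set.indicator_of_mem (show sph ρ θ ∈ S ∩ cap R from
            ⟨hs, (sph_mem_cap_iff hR0 hR1 hρ θ).2 hA⟩)]
      · rw [Set.indicator_of_notMem hs, Set.indicator_of_notMem fun h => hs h.1]
    · rw [Set.indicator_of_notMem fun h : ρ ∈ Set.Ioo 0 (capAngle R) => hA h.2,
        Set.indicator_of_notMem fun h => hA ((sph_mem_cap_iff hR0 hR1 hρ θ).1 h.2), mul_zero]
  · rw [Set.indicator_of_notMem hρ, Set.indicator_of_notMem fun h : ρ ∈ Set.Ioo 0 (capAngle R) =>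
      hρ ⟨h.1, h.2.trans hAπ⟩]

/-- The area element `sin ρ dρ dθ` on `(0, A) × (-π, π)`. -/
noncomputable def polarMeasure (A : ℝ) : Measure (ℝ × ℝ) :=
  ((volume.restrict (Set.Ioo 0 A)).prod (volume.restrict (Set.Ioo (-π) π))).withDensity
    fun p => ENNReal.ofReal (sin p.1)

theorem areaMeasure_eq_map {R : ℝ} (hR0 : 0 < R) (hR1 : R ≤ 1) :
    areaMeasure R = (polarMeasure (capAngle R)).map fun p => sph p.1 p.2 := by
  refine Measure.ext fun S hS => ?_
  have hsph : Measurable fun p : ℝ × ℝ => sph p.1 p.2 := continuous_sph.measurable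
  have hone : Measurable (S.indicator (1 : E3 → ℝ≥0∞)) := measurable_one.indicator hS
  have hind : Measurable fun p : ℝ × ℝ =>
      ENNReal.ofReal (sin p.1) * S.indicator (1 : E3 → ℝ≥0∞) (sph p.1 p.2) :=
    Measurable.mul (by fun_prop) (hone.comp hsph)
  rw [areaMeasure_apply hR0 hR1 hS, Measure.map_apply hsph hS, polarMeasure,
    withDensity_apply _ (hsph hS), ← lintegral_indicator (hsph hS),
    ← lintegral_prod_symm' (μ := volume.restrict (Set.Ioo 0 (capAngle R)))
      (ν := volume.restrict (Set.Ioo (-π) π)) _ hind]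
  congr 1; funext p
  by_cases hp : sph p.1 p.2 ∈ S
  · rw [Set.indicator_of_mem hp,
      Set.indicator_of_mem (show p ∈ (fun p : ℝ × ℝ => sph p.1 p.2) ⁻¹' S from hp)]
    simp
  · rw [Set.indicator_of_notMem hp,
      Set.indicator_of_notMem (show p ∉ (fun p : ℝ × ℝ => sph p.1 p.2) ⁻¹' S from hp),
      mul_zero]

theorem sph_periodic (ρ : ℝ) : Function.Periodic (sph ρ) (2 * π) := fun θ => by
  simp [sph]

theorem integral_areaMeasure {R : ℝ} (hR0 : 0 < R) (hR1 : R ≤ 1) {g : E3 → ℝ} (hg : Continuous g) :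
    ∫ x, g x ∂areaMeasure R
      = ∫ ρ in 0..capAngle R, sin ρ * ∫ θ in 0..2 * π, g (sph ρ θ) := by
  have hgs : Continuous fun p : ℝ × ℝ => g (sph p.1 p.2) := hg.comp continuous_sph
  have hAπ : capAngle R < π := by linarith [capAngle_le hR0 hR1, pi_pos]
  rw [areaMeasure_eq_map hR0 hR1, integral_map continuous_sph.aemeasurable
    hg.aestronglyMeasurable, polarMeasure, integral_withDensity_eq_integral_toReal_smul
    (by fun_prop) (by simp), integral_prod, intervalIntegral.integral_of_le (capAngle_pos hR0).le,
    integral_Ioc_eq_integral_Ioo]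
  · refine setIntegral_congr_fun measurableSet_Ioo fun ρ hρ => ?_
    have hs : 0 ≤ sin ρ := sin_nonneg_of_nonneg_of_le_pi hρ.1.le (by linarith [hρ.2])
    simp only [ENNReal.toReal_ofReal hs, smul_eq_mul]
    rw [integral_const_mul, ← integral_Ioc_eq_integral_Ioo,
      ← intervalIntegral.integral_of_le (by linarith [pi_pos])]
    congr 1
    -- Planar polar coordinates use the angles `(-π, π)`; periodicity moves the integral to `(0,
    -- 2π)`.
    have hp : Function.Periodic (fun θ => g (sph ρ θ)) (2 * π) := fun θ => by
      simp only [sph_periodic ρ θ]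
    have := hp.intervalIntegral_add_eq (-π) 0
    rw [zero_add, show -π + 2 * π = π by ring] at this
    exact this
  · rw [Measure.prod_restrict]
    refine IntegrableOn.mono_set (t := Set.Icc 0 (capAngle R) ×ˢ Set.Icc (-π) π) ?_
      (Set.prod_mono Set.Ioo_subset_Icc_self Set.Ioo_subset_Icc_self)
    refine ContinuousOn.integrableOn_compact (isCompact_Icc.prod isCompact_Icc) ?_
    simp only [smul_eq_mul, ENNReal.toReal_ofReal']
    exact Continuous.continuousOn ((by fun_prop : Continuous fun p : ℝ × ℝ => max (sin p.1) 0).mul hgs)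

theorem boundaryCurve_eq_sph {R : ℝ} (hR0 : 0 < R) (hR1 : R ≤ 1) (θ : ℝ) :
    boundaryCurve R θ = sph (capAngle R) θ := by
  rw [boundaryCurve, sph, sin_capAngle hR0, cos_capAngle hR0 hR1]

theorem integral_arcMeasure {R : ℝ} (hR0 : 0 < R) (hR1 : R ≤ 1) {g : E3 → ℝ} (hg : Continuous g) :
    ∫ x, g x ∂arcMeasure R = capRadius R * ∫ θ in 0..2 * π, g (sph (capAngle R) θ) := by
  rw [arcMeasure, integral_smul_measure, integral_map (measurable_boundaryCurve R).aemeasurable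
    hg.aestronglyMeasurable, ← intervalIntegral.integral_of_le two_pi_pos.le,
    ENNReal.toReal_ofReal (capRadius_pos hR0).le]
  simp_rw [boundaryCurve_eq_sph hR0 hR1, smul_eq_mul]

theorem integrable_of_continuous {μ : Measure E3} [IsFiniteMeasure μ] (hμ : ∀ᵐ x ∂μ, ‖x‖ = 1)
    {g : E3 → ℝ} (hg : Continuous g) : Integrable g μ :=
  (memLp_of_continuous hμ hg).integrable one_le_two

theorem integral_hatMeasure {R : ℝ} (hR0 : 0 < R) (hR1 : R ≤ 1) {g : E3 → ℝ} (hg : Continuous g) :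
    ∫ x, g x ∂hatMeasure R
      = 2 * (∫ ρ in 0..capAngle R, sin ρ * ∫ θ in 0..2 * π, g (sph ρ θ))
        + cos (capAngle R) * ∫ θ in 0..2 * π, g (sph (capAngle R) θ) := by
  rw [hatMeasure, integral_add_measure, integral_smul_measure, integral_smul_measure,
    integral_areaMeasure hR0 hR1 hg, integral_arcMeasure hR0 hR1 hg,
    ENNReal.toReal_ofReal (boundaryCurvature_nonneg hR0 hR1), cos_capAngle hR0 hR1,
    ← boundaryCurvature_mul_capRadius hR0]
  · simp [mul_assoc]
  · exact (integrable_of_continuous (ae_norm_areaMeasure R) hg).smul_measure (by simp)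
  · exact (integrable_of_continuous (ae_norm_arcMeasure R) hg).smul_measure (by simp)

/-! ### Smooth functions in spherical coordinates -/

/-- The unit tangent vector to the meridian. -/
noncomputable def sphRadial (ρ θ : ℝ) : E3 := !₂[cos ρ * cos θ, cos ρ * sin θ, -sin ρ]

/-- The unit tangent vector to the circle of latitude. -/
noncomputable def sphAngular (θ : ℝ) : E3 := !₂[-sin θ, cos θ, 0]

theorem hasDerivAt_of_coord {f : ℝ → E3} {f' : E3} {t : ℝ}
    (h : ∀ i, HasDerivAt (fun x => f x i) (f' i) t) : HasDerivAt f f' t := by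
  have h1 : HasDerivAt (fun x => (f x).ofLp) f'.ofLp t := hasDerivAt_pi.2 h
  exact ((PiLp.continuousLinearEquiv 2 ℝ (fun _ : Fin 3 => ℝ)).symm.hasFDerivAt).comp_hasDerivAt t h1

theorem hasDerivAt_sph_radial (ρ θ : ℝ) :
    HasDerivAt (fun ρ => sph ρ θ) (sphRadial ρ θ) ρ := by
  refine hasDerivAt_of_coord fun i => ?_
  fin_cases i
  · exact (hasDerivAt_sin ρ).mul_const (cos θ)
  · exact (hasDerivAt_sin ρ).mul_const (sin θ)
  · exact hasDerivAt_cos ρ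

theorem hasDerivAt_sph_angular (ρ θ : ℝ) :
    HasDerivAt (sph ρ) (sin ρ • sphAngular θ) θ := by
  refine hasDerivAt_of_coord fun i => ?_
  fin_cases i
  · exact (hasDerivAt_cos θ).const_mul (sin ρ)
  · exact (hasDerivAt_sin θ).const_mul (sin ρ)
  · simpa [sphAngular] using! hasDerivAt_const θ (cos ρ)

theorem isPolarSmooth {φ : E3 → ℝ} (hφ : ContDiff ℝ ∞ φ) :
    IsPolarSmooth (fun ρ θ => φ (sph ρ θ)) (fun ρ θ => fderiv ℝ φ (sph ρ θ) (sphRadial ρ θ))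
      (fun ρ θ => fderiv ℝ φ (sph ρ θ) (sphAngular θ)) where
  continuous := hφ.continuous.comp continuous_sph
  continuous_radial := ((hφ.continuous_fderiv (by simp)).comp continuous_sph).clm_apply
    (show Continuous fun p : ℝ × ℝ => sphRadial p.1 p.2 by unfold sphRadial; fun_prop)
  continuous_angular := ((hφ.continuous_fderiv (by simp)).comp continuous_sph).clm_apply
    (show Continuous fun p : ℝ × ℝ => sphAngular p.2 by unfold sphAngular; fun_prop)
  hasDerivAt_radial ρ θ := ((hφ.differentiable (by simp) _).hasFDerivAt).comp_hasDerivAt ρ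
    (hasDerivAt_sph_radial ρ θ)
  hasDerivAt_angular ρ θ := by
    have := ((hφ.differentiable (by simp) _).hasFDerivAt).comp_hasDerivAt θ
      (hasDerivAt_sph_angular ρ θ)
    simpa using! this
  periodic ρ := by have := sph_periodic ρ 0; rw [zero_add] at this; rw [this]
  pole θ := by simp [sph]

/-- The position vector and the two unit tangent vectors form an orthonormal basis of `ℝ³`. -/
theorem inner_eq_sph_frame (u v : E3) (ρ θ : ℝ) :
    inner ℝ u v = inner ℝ u (sph ρ θ) * inner ℝ v (sph ρ θ)
      + inner ℝ u (sphRadial ρ θ) * inner ℝ v (sphRadial ρ θ)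
      + inner ℝ u (sphAngular θ) * inner ℝ v (sphAngular θ) := by
  have h1 := sin_sq_add_cos_sq ρ
  have h2 := sin_sq_add_cos_sq θ
  simp only [PiLp.inner_apply, Fin.sum_univ_three, sph, sphRadial, sphAngular, Matrix.cons_val,
    RCLike.inner_apply, conj_trivial]
  linear_combination (-((u 0 * cos θ + u 1 * sin θ) * (v 0 * cos θ + v 1 * sin θ) + u 2 * v 2)) * h1
    - (u 0 * v 0 + u 1 * v 1) * h2

theorem inner_sphereGrad (φ ψ : E3 → ℝ) (ρ θ : ℝ) :
    inner ℝ (sphereGrad φ (sph ρ θ)) (sphereGrad ψ (sph ρ θ))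
      = fderiv ℝ φ (sph ρ θ) (sphRadial ρ θ) * fderiv ℝ ψ (sph ρ θ) (sphRadial ρ θ)
        + fderiv ℝ φ (sph ρ θ) (sphAngular θ) * fderiv ℝ ψ (sph ρ θ) (sphAngular θ) := by
  have h := inner_eq_sph_frame (gradient φ (sph ρ θ)) (gradient ψ (sph ρ θ)) ρ θ
  have hg : ∀ (f : E3 → ℝ) (x v : E3), inner ℝ (gradient f x) v = fderiv ℝ f x v := fun f x v => by
    simp [gradient]
  have hn : inner ℝ (sph ρ θ) (sph ρ θ) = 1 := by
    rw [real_inner_self_eq_norm_sq, norm_sph]; norm_num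
  rw [← hg, ← hg, ← hg, ← hg]
  simp only [sphereGrad, inner_sub_left, inner_sub_right, inner_smul_left, inner_smul_right,
    conj_trivial, hn, real_inner_comm (gradient ψ (sph ρ θ)) (sph ρ θ)]
  rw [h]
  ring

/-! ### The Sobolev space -/

/-- The class in `H¹` of a smooth function, as a linear map. -/
noncomputable def smoothClass (R : ℝ) : smoothFun →ₗ[ℝ] H1 R :=
  (smoothGraph R).codRestrict (H1 R) fun _ =>
    Submodule.le_topologicalClosure _ (LinearMap.mem_range_self _ _)

/-- `toL2` as a continuous linear map. -/
noncomputable def toL2L (R : ℝ) : H1 R →L[ℝ] L2hat R :=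
  (ContinuousLinearMap.fst ℝ (L2hat R) (L2grad R)).comp (H1 R).subtypeL

/-- `weakGrad` as a continuous linear map. -/
noncomputable def weakGradL (R : ℝ) : H1 R →L[ℝ] L2grad R :=
  (ContinuousLinearMap.snd ℝ (L2hat R) (L2grad R)).comp (H1 R).subtypeL

section Sobolev

variable {R : ℝ}

theorem continuous_toL2 : Continuous (toL2 : H1 R → L2hat R) := (toL2L R).continuous

theorem continuous_weakGrad : Continuous (weakGrad : H1 R → L2grad R) := (weakGradL R).continuous

theorem toL2_add (v w : H1 R) : toL2 (v + w) = toL2 v + toL2 w := rfl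

theorem weakGrad_add (v w : H1 R) : weakGrad (v + w) = weakGrad v + weakGrad w := rfl

theorem eq_zero_of_toL2_of_weakGrad {v : H1 R} (h1 : toL2 v = 0) (h2 : weakGrad v = 0) : v = 0 :=
  Subtype.ext (Prod.ext h1 h2)

theorem denseRange_smoothClass : DenseRange (smoothClass R) := by
  intro v
  rw [closure_subtype]
  have hv : (v : L2hat R × L2grad R) ∈ closure (LinearMap.range (smoothGraph R) : Set _) := v.2
  convert hv using 2
  ext w
  constructor
  · rintro ⟨-, ⟨φ, rfl⟩, rfl⟩
    exact ⟨φ, rfl⟩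
  · rintro ⟨φ, rfl⟩
    exact ⟨smoothClass R φ, ⟨φ, rfl⟩, rfl⟩

theorem coeFn_toL2_smoothClass (φ : smoothFun) :
    toL2 (smoothClass R φ) =ᵐ[hatMeasure R] φ.1 :=
  MemLp.coeFn_toLp (memLp_of_continuous (ae_norm_hatMeasure R) (smoothFun.contDiff φ).continuous)

theorem coeFn_weakGrad_smoothClass (φ : smoothFun) :
    weakGrad (smoothClass R φ) =ᵐ[areaMeasure R] sphereGrad φ.1 :=
  MemLp.coeFn_toLp
    (memLp_of_continuous (ae_norm_areaMeasure R) (continuous_sphereGrad (smoothFun.contDiff φ)))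

theorem inner_toL2_smoothClass (φ ψ : smoothFun) :
    inner ℝ (toL2 (smoothClass R φ)) (toL2 (smoothClass R ψ))
      = ∫ x, φ.1 x * ψ.1 x ∂hatMeasure R := by
  rw [L2.inner_def]
  refine integral_congr_ae ?_
  filter_upwards [coeFn_toL2_smoothClass φ, coeFn_toL2_smoothClass ψ] with x hx1 hx2
  rw [hx1, hx2]
  simp [mul_comm]

theorem inner_weakGrad_smoothClass (φ ψ : smoothFun) :
    inner ℝ (weakGrad (smoothClass R φ)) (weakGrad (smoothClass R ψ))
      = ∫ x, inner ℝ (sphereGrad φ.1 x) (sphereGrad ψ.1 x) ∂areaMeasure R := by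
  rw [L2.inner_def]
  refine integral_congr_ae ?_
  filter_upwards [coeFn_weakGrad_smoothClass φ, coeFn_weakGrad_smoothClass ψ] with x hx1 hx2
  rw [hx1, hx2]

theorem inner_toL2_polar (hR0 : 0 < R) (hR1 : R ≤ 1) (φ ψ : smoothFun) :
    inner ℝ (toL2 (smoothClass R φ)) (toL2 (smoothClass R ψ))
      = 2 * (∫ ρ in 0..capAngle R, sin ρ * ∫ θ in 0..2 * π, φ.1 (sph ρ θ) * ψ.1 (sph ρ θ))
        + cos (capAngle R) *
          ∫ θ in 0..2 * π, φ.1 (sph (capAngle R) θ) * ψ.1 (sph (capAngle R) θ) := by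
  rw [inner_toL2_smoothClass, integral_hatMeasure hR0 hR1 (g := fun x => φ.1 x * ψ.1 x)
    ((smoothFun.contDiff φ).continuous.mul (smoothFun.contDiff ψ).continuous)]

theorem inner_weakGrad_polar (hR0 : 0 < R) (hR1 : R ≤ 1) (φ ψ : smoothFun) :
    inner ℝ (weakGrad (smoothClass R φ)) (weakGrad (smoothClass R ψ))
      = ∫ ρ in 0..capAngle R, sin ρ * ∫ θ in 0..2 * π,
        (fderiv ℝ φ.1 (sph ρ θ) (sphRadial ρ θ) * fderiv ℝ ψ.1 (sph ρ θ) (sphRadial ρ θ)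
        + fderiv ℝ φ.1 (sph ρ θ) (sphAngular θ) * fderiv ℝ ψ.1 (sph ρ θ) (sphAngular θ)) := by
  rw [inner_weakGrad_smoothClass, integral_areaMeasure hR0 hR1
    ((continuous_sphereGrad (smoothFun.contDiff φ)).inner
      (continuous_sphereGrad (smoothFun.contDiff ψ)))]
  simp_rw [inner_sphereGrad]

end Sobolev

/-! ### The first three eigenfunctions -/

/-- The functions `1, X₁, X₂`. -/
noncomputable def lowFun : Fin 3 → smoothFun :=
  ![⟨fun _ => 1, (contDiff_const : ContDiff ℝ ∞ fun _ : E3 => (1 : ℝ))⟩,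
    ⟨coord 0, contDiff_coord 0⟩, ⟨coord 1, contDiff_coord 1⟩]

/-- The classes of `1, X₁, X₂` in `H¹`. -/
noncomputable def lowMode (R : ℝ) (i : Fin 3) : H1 R := smoothClass R (lowFun i)

/-- The eigenvalues of `1, X₁, X₂`. -/
noncomputable def lowValue : Fin 3 → ℝ := ![0, 1, 1]

theorem fderiv_coord (i : Fin 3) (x v : E3) : fderiv ℝ (coord i) x v = v i := by
  have : HasFDerivAt (coord i) (EuclideanSpace.proj i : E3 →L[ℝ] ℝ) x :=
    (EuclideanSpace.proj i : E3 →L[ℝ] ℝ).hasFDerivAt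
  rw [this.fderiv]; rfl

section Low

variable {R : ℝ}

/-- For `X₁` and `X₂` the tangential components of the gradient are `cos ρ · w θ` and `w' θ`, with
`w = cos` and `w = sin` respectively. -/
theorem weak_lowFun (hR0 : 0 < R) (hR1 : R ≤ 1) (i : Fin 3) (ψ : smoothFun) :
    inner ℝ (weakGrad (smoothClass R (lowFun i))) (weakGrad (smoothClass R ψ))
      = lowValue i * inner ℝ (toL2 (smoothClass R (lowFun i))) (toL2 (smoothClass R ψ)) := by
  rw [inner_weakGrad_polar hR0 hR1, inner_toL2_polar hR0 hR1]
  have hψ := isPolarSmooth (smoothFun.contDiff ψ)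
  fin_cases i
  · simp [lowFun, lowValue]
  · simp only [lowFun, lowValue, Fin.mk_one, Matrix.cons_val, fderiv_coord, one_mul]
    exact hψ.weak_mode_one (capAngle R) (w := cos) (w' := fun θ => -sin θ) hasDerivAt_cos
      (fun θ => (hasDerivAt_sin θ).neg) (by simp)
  · simp only [lowFun, lowValue, Fin.reduceFinMk, Matrix.cons_val, fderiv_coord, one_mul]
    exact hψ.weak_mode_one (capAngle R) (w := sin) (w' := cos) hasDerivAt_sin hasDerivAt_cos (by simp)

theorem weak_lowMode (hR0 : 0 < R) (hR1 : R ≤ 1) (i : Fin 3) (v : H1 R) :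
    inner ℝ (weakGrad (lowMode R i)) (weakGrad v)
      = lowValue i * inner ℝ (toL2 (lowMode R i)) (toL2 v) := by
  refine denseRange_smoothClass.induction_on
    (p := fun v => inner ℝ (weakGrad (lowMode R i)) (weakGrad v)
      = lowValue i * inner ℝ (toL2 (lowMode R i)) (toL2 v)) v ?_ fun ψ => weak_lowFun hR0 hR1 i ψ
  exact isClosed_eq (continuous_const.inner continuous_weakGrad)
    (continuous_const.mul (continuous_const.inner continuous_toL2))

theorem inner_toL2_lowMode (hR0 : 0 < R) (hR1 : R ≤ 1) {i j : Fin 3} (hij : i ≠ j) :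
    inner ℝ (toL2 (lowMode R i)) (toL2 (lowMode R j)) = 0 := by
  have hc : ∀ ρ, ∫ θ in 0..2 * π, sin ρ * cos θ = 0 := fun ρ => by
    rw [intervalIntegral.integral_const_mul, integral_cos_two_pi, mul_zero]
  have hs : ∀ ρ, ∫ θ in 0..2 * π, sin ρ * sin θ = 0 := fun ρ => by
    rw [intervalIntegral.integral_const_mul, integral_sin_two_pi, mul_zero]
  have hcs : ∀ ρ, ∫ θ in 0..2 * π, sin ρ * cos θ * (sin ρ * sin θ) = 0 := fun ρ => by
    have : ∀ θ, sin ρ * cos θ * (sin ρ * sin θ) = sin ρ ^ 2 * (sin θ * cos θ) := fun θ => by ring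
    simp_rw [this]
    rw [intervalIntegral.integral_const_mul, integral_sin_mul_cos_two_pi, mul_zero]
  have key : ∀ i j : Fin 3, i < j →
      inner ℝ (toL2 (lowMode R i)) (toL2 (lowMode R j)) = 0 := by
    intro i j hij
    rw [lowMode, lowMode, inner_toL2_polar hR0 hR1]
    fin_cases i <;> fin_cases j <;>
      simp [lowFun, coord, sph, hc, hs, hcs, -intervalIntegral.integral_const_mul,
        -intervalIntegral.integral_mul_const] at hij ⊢
  rcases lt_or_gt_of_ne hij with h | h
  · exact key i j h
  · rw [real_inner_comm]; exact key j i h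

theorem inner_toL2_lowMode_self_pos (hR0 : 0 < R) (hR1 : R ≤ 1) (i : Fin 3) :
    0 < inner ℝ (toL2 (lowMode R i)) (toL2 (lowMode R i)) := by
  have hA := capAngle_pos hR0
  have hA' := capAngle_le hR0 hR1
  have hcA : 0 ≤ cos (capAngle R) := by
    rw [cos_capAngle hR0 hR1]; exact capHeight_nonneg hR0 hR1
  rw [lowMode, inner_toL2_polar hR0 hR1]
  refine add_pos_of_pos_of_nonneg (mul_pos two_pos ?_) (mul_nonneg hcA
    (intervalIntegral.integral_nonneg two_pi_pos.le fun θ _ => mul_self_nonneg _))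
  have hpos : ∀ ρ ∈ Set.Ioo 0 (capAngle R), 0 < sin ρ := fun ρ hρ =>
    sin_pos_of_pos_of_lt_pi hρ.1 (by linarith [hρ.2, pi_pos])
  have hint : ∀ ρ, 0 < sin ρ → 0 < ∫ θ in 0..2 * π, (lowFun i).1 (sph ρ θ) * (lowFun i).1 (sph ρ θ) := by
    intro ρ hs
    have hc : ∫ θ in 0..2 * π, sin ρ * cos θ * (sin ρ * cos θ) = sin ρ ^ 2 * π := by
      have e : ∀ θ, sin ρ * cos θ * (sin ρ * cos θ) = sin ρ ^ 2 * cos θ ^ 2 := fun θ => by ring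
      simp_rw [e]
      rw [intervalIntegral.integral_const_mul, integral_cos_sq_two_pi]
    have hs' : ∫ θ in 0..2 * π, sin ρ * sin θ * (sin ρ * sin θ) = sin ρ ^ 2 * π := by
      have e : ∀ θ, sin ρ * sin θ * (sin ρ * sin θ) = sin ρ ^ 2 * sin θ ^ 2 := fun θ => by ring
      simp_rw [e]
      rw [intervalIntegral.integral_const_mul, integral_sin_sq_two_pi]
    fin_cases i
    · simp [lowFun, pi_pos]
    · change 0 < ∫ θ in 0..2 * π, sin ρ * cos θ * (sin ρ * cos θ)
      rw [hc]; positivity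
    · change 0 < ∫ θ in 0..2 * π, sin ρ * sin θ * (sin ρ * sin θ)
      rw [hs']; positivity
  refine intervalIntegral.intervalIntegral_pos_of_pos_on ?_
    (fun ρ hρ => mul_pos (hpos ρ hρ) (hint ρ (hpos ρ hρ))) hA
  have hc : Continuous fun p : ℝ × ℝ => (lowFun i).1 (sph p.1 p.2) :=
    (smoothFun.contDiff (lowFun i)).continuous.comp continuous_sph
  exact (continuous_sin.mul (continuous_integral_circle
    (F := fun ρ θ => (lowFun i).1 (sph ρ θ) * (lowFun i).1 (sph ρ θ))
    (hc.mul hc))).intervalIntegrable _ _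

theorem gap_smoothClass (hR0 : 0 < R) (hR1 : R ≤ 1) (φ : smoothFun)
    (h : ∀ i, inner ℝ (toL2 (lowMode R i)) (toL2 (smoothClass R φ)) = 0) :
    11 / 10 * ‖toL2 (smoothClass R φ)‖ ^ 2 ≤ ‖weakGrad (smoothClass R φ)‖ ^ 2 := by
  rw [← real_inner_self_eq_norm_sq, ← real_inner_self_eq_norm_sq, inner_toL2_polar hR0 hR1,
    inner_weakGrad_polar hR0 hR1]
  have h' : ∀ i, inner ℝ (toL2 (smoothClass R φ)) (toL2 (smoothClass R (lowFun i))) = 0 :=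
    fun i => by rw [real_inner_comm]; exact h i
  have h0 := h' 0
  have h1 := h' 1
  have h2 := h' 2
  rw [inner_toL2_polar hR0 hR1] at h0 h1 h2
  have := (isPolarSmooth (smoothFun.contDiff φ)).gap (capAngle_pos hR0) (capAngle_le hR0 hR1)
    (by simpa [lowFun] using h0) h1 h2
  simpa only [sq] using this

/-- The component of `v` orthogonal to `1, X₁, X₂` in `L²(μ̂_R)`. -/
noncomputable def highMode (v : H1 R) : H1 R :=
  v - ∑ i, (inner ℝ (toL2 (lowMode R i)) (toL2 v)
    / inner ℝ (toL2 (lowMode R i)) (toL2 (lowMode R i))) • lowMode R i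

theorem toL2_highMode (v : H1 R) : toL2 (highMode v) = toL2 v
    - ∑ i, (inner ℝ (toL2 (lowMode R i)) (toL2 v)
      / inner ℝ (toL2 (lowMode R i)) (toL2 (lowMode R i))) • toL2 (lowMode R i) := by
  change toL2L R (highMode v) = _
  simp only [highMode, map_sub, map_sum, map_smul]
  rfl

theorem inner_lowMode_highMode (hR0 : 0 < R) (hR1 : R ≤ 1) (i : Fin 3) (v : H1 R) :
    inner ℝ (toL2 (lowMode R i)) (toL2 (highMode v)) = 0 := by
  rw [toL2_highMode, inner_sub_right, inner_sum, Finset.sum_eq_single i]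
  · rw [inner_smul_right, div_mul_cancel₀ _ (inner_toL2_lowMode_self_pos hR0 hR1 i).ne', sub_self]
  · intro j _ hj
    rw [inner_smul_right, inner_toL2_lowMode hR0 hR1 hj.symm, mul_zero]
  · simp

/-- The inequality is stated for the projection of an arbitrary `v`, because smooth approximations
of an orthogonal `v` need not be orthogonal. The projection is continuous and maps classes of smooth
functions to such classes, so density applies. -/
theorem gap_highMode (hR0 : 0 < R) (hR1 : R ≤ 1) (v : H1 R) :
    11 / 10 * ‖toL2 (highMode v)‖ ^ 2 ≤ ‖weakGrad (highMode v)‖ ^ 2 := by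
  have hcont : Continuous (highMode : H1 R → H1 R) := by
    have hc : ∀ i, Continuous fun v : H1 R => inner ℝ (toL2 (lowMode R i)) (toL2 v)
        / inner ℝ (toL2 (lowMode R i)) (toL2 (lowMode R i)) := fun i =>
      (continuous_const.inner continuous_toL2).div_const _
    exact continuous_id.sub (continuous_finsetSum _ fun i _ => (hc i).smul continuous_const)
  refine denseRange_smoothClass.induction_on
    (p := fun v => 11 / 10 * ‖toL2 (highMode v)‖ ^ 2 ≤ ‖weakGrad (highMode v)‖ ^ 2) v ?_ fun φ => ?_
  · exact isClosed_le (continuous_const.mul ((continuous_toL2.comp hcont).norm.pow 2))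
      ((continuous_weakGrad.comp hcont).norm.pow 2)
  · have e : highMode (smoothClass R φ) = smoothClass R (φ
        - ∑ i, (inner ℝ (toL2 (lowMode R i)) (toL2 (smoothClass R φ))
          / inner ℝ (toL2 (lowMode R i)) (toL2 (lowMode R i))) • lowFun i) := by
      simp only [highMode, map_sub, map_sum, map_smul]
      rfl
    rw [e]
    refine gap_smoothClass hR0 hR1 _ fun i => ?_
    rw [← e]
    exact inner_lowMode_highMode hR0 hR1 i _

end Low

/-! ### Orthogonal splitting of `H¹` into low and high modes -/

theorem lowValue_of_ne {i : Fin 3} (hi : i ≠ 0) : lowValue i = 1 := by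
  fin_cases i
  · exact absurd rfl hi
  · rfl
  · rfl

section Spectrum

variable {R : ℝ}

/-- The linear combination of `1, X₁, X₂` with coefficients `c`. -/
noncomputable def lowSum (R : ℝ) (c : Fin 3 → ℝ) : H1 R := ∑ i, c i • lowMode R i

theorem toL2_lowSum (c : Fin 3 → ℝ) : toL2 (lowSum R c) = ∑ i, c i • toL2 (lowMode R i) := by
  change toL2L R (lowSum R c) = _
  simp only [lowSum, map_sum, map_smul]
  rfl

theorem weakGrad_lowSum (c : Fin 3 → ℝ) :
    weakGrad (lowSum R c) = ∑ i, c i • weakGrad (lowMode R i) := by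
  change weakGradL R (lowSum R c) = _
  simp only [lowSum, map_sum, map_smul]
  rfl

theorem inner_toL2_lowSum (c : Fin 3 → ℝ) (v : L2hat R) :
    inner ℝ (toL2 (lowSum R c)) v = ∑ i, c i * inner ℝ (toL2 (lowMode R i)) v := by
  rw [toL2_lowSum, sum_inner]
  exact Finset.sum_congr rfl fun i _ => real_inner_smul_left _ _ _

theorem inner_weakGrad_lowSum (hR0 : 0 < R) (hR1 : R ≤ 1) (c : Fin 3 → ℝ) (v : H1 R) :
    inner ℝ (weakGrad (lowSum R c)) (weakGrad v)
      = ∑ i, lowValue i * (c i * inner ℝ (toL2 (lowMode R i)) (toL2 v)) := by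
  rw [weakGrad_lowSum, sum_inner]
  refine Finset.sum_congr rfl fun i _ => ?_
  rw [real_inner_smul_left, weak_lowMode hR0 hR1]
  ring

theorem inner_toL2_lowMode_lowSum (hR0 : 0 < R) (hR1 : R ≤ 1) (i : Fin 3) (c : Fin 3 → ℝ) :
    inner ℝ (toL2 (lowMode R i)) (toL2 (lowSum R c))
      = c i * inner ℝ (toL2 (lowMode R i)) (toL2 (lowMode R i)) := by
  rw [real_inner_comm, inner_toL2_lowSum, Finset.sum_eq_single i]
  · intro j _ hj
    rw [inner_toL2_lowMode hR0 hR1 hj, mul_zero]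
  · simp

theorem norm_toL2_lowSum_sq (hR0 : 0 < R) (hR1 : R ≤ 1) (c : Fin 3 → ℝ) :
    ‖toL2 (lowSum R c)‖ ^ 2
      = ∑ i, c i ^ 2 * inner ℝ (toL2 (lowMode R i)) (toL2 (lowMode R i)) := by
  rw [← real_inner_self_eq_norm_sq, inner_toL2_lowSum]
  refine Finset.sum_congr rfl fun i _ => ?_
  rw [inner_toL2_lowMode_lowSum hR0 hR1]
  ring

theorem norm_weakGrad_lowSum_sq (hR0 : 0 < R) (hR1 : R ≤ 1) (c : Fin 3 → ℝ) :
    ‖weakGrad (lowSum R c)‖ ^ 2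
      = ∑ i, lowValue i * (c i ^ 2 * inner ℝ (toL2 (lowMode R i)) (toL2 (lowMode R i))) := by
  rw [← real_inner_self_eq_norm_sq, inner_weakGrad_lowSum hR0 hR1]
  refine Finset.sum_congr rfl fun i _ => ?_
  rw [inner_toL2_lowMode_lowSum hR0 hR1]
  ring

/-- By the weak equation, a function that is `L²(μ̂)`-orthogonal to the low modes also has gradient
orthogonal to theirs, so both squared norms are additive. -/
theorem exists_eq_highMode_add_lowSum (hR0 : 0 < R) (hR1 : R ≤ 1) (v : H1 R) :
    ∃ c : Fin 3 → ℝ, v = highMode v + lowSum R c ∧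
      (∀ i, inner ℝ (toL2 (lowMode R i)) (toL2 v)
        = c i * inner ℝ (toL2 (lowMode R i)) (toL2 (lowMode R i))) ∧
      ‖toL2 v‖ ^ 2 = ‖toL2 (highMode v)‖ ^ 2 + ‖toL2 (lowSum R c)‖ ^ 2 ∧
      ‖weakGrad v‖ ^ 2 = ‖weakGrad (highMode v)‖ ^ 2 + ‖weakGrad (lowSum R c)‖ ^ 2 := by
  set c : Fin 3 → ℝ := fun i => inner ℝ (toL2 (lowMode R i)) (toL2 v)
    / inner ℝ (toL2 (lowMode R i)) (toL2 (lowMode R i)) with hc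
  have hv : v = highMode v + lowSum R c := by simp [highMode, lowSum, hc]
  refine ⟨c, hv, fun i => ?_, ?_, ?_⟩
  · rw [hc]
    exact (div_mul_cancel₀ _ (inner_toL2_lowMode_self_pos hR0 hR1 i).ne').symm
  · conv_lhs => rw [hv, toL2_add, add_comm, norm_add_sq_real, inner_toL2_lowSum]
    simp only [inner_lowMode_highMode hR0 hR1]
    simp; ring
  · conv_lhs => rw [hv, weakGrad_add, add_comm, norm_add_sq_real, inner_weakGrad_lowSum hR0 hR1]
    simp only [inner_lowMode_highMode hR0 hR1]
    simp; ring

theorem norm_weakGrad_lowSum_eq (hR0 : 0 < R) (hR1 : R ≤ 1) {c : Fin 3 → ℝ} (hc : c 0 = 0) :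
    ‖weakGrad (lowSum R c)‖ ^ 2 = ‖toL2 (lowSum R c)‖ ^ 2 := by
  rw [norm_weakGrad_lowSum_sq hR0 hR1, norm_toL2_lowSum_sq hR0 hR1]
  simp [Fin.sum_univ_three, lowValue, hc]

theorem norm_weakGrad_lowSum_le (hR0 : 0 < R) (hR1 : R ≤ 1) (c : Fin 3 → ℝ) :
    ‖weakGrad (lowSum R c)‖ ^ 2 ≤ ‖toL2 (lowSum R c)‖ ^ 2 := by
  rw [norm_weakGrad_lowSum_sq hR0 hR1, norm_toL2_lowSum_sq hR0 hR1]
  refine Finset.sum_le_sum fun i _ => mul_le_of_le_one_left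
    (mul_nonneg (sq_nonneg _) (inner_toL2_lowMode_self_pos hR0 hR1 i).le) ?_
  fin_cases i <;> simp [lowValue]

theorem coeff_eq_zero (hR0 : 0 < R) (hR1 : R ≤ 1) {v : H1 R} {c : Fin 3 → ℝ} {i : Fin 3}
    (h : inner ℝ (toL2 (lowMode R i)) (toL2 v)
        = c i * inner ℝ (toL2 (lowMode R i)) (toL2 (lowMode R i)))
    (h0 : inner ℝ (toL2 (lowMode R i)) (toL2 v) = 0) : c i = 0 := by
  rw [h0] at h
  exact (mul_eq_zero.1 h.symm).resolve_right (inner_toL2_lowMode_self_pos hR0 hR1 i).ne'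

/-- The Poincaré inequality for functions of mean zero. -/
theorem poincare (hR0 : 0 < R) (hR1 : R ≤ 1) {v : H1 R}
    (h0 : inner ℝ (toL2 (lowMode R 0)) (toL2 v) = 0) : ‖toL2 v‖ ^ 2 ≤ ‖weakGrad v‖ ^ 2 := by
  obtain ⟨c, -, hc, h1, h2⟩ := exists_eq_highMode_add_lowSum hR0 hR1 v
  have h3 := norm_weakGrad_lowSum_eq hR0 hR1 (coeff_eq_zero hR0 hR1 (hc 0) h0)
  have h4 := gap_highMode hR0 hR1 v
  have h5 := sq_nonneg ‖toL2 (highMode v)‖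
  linarith

/-- The strict Poincaré inequality for functions orthogonal to `1, X₁, X₂`. -/
theorem spectral_gap (hR0 : 0 < R) (hR1 : R ≤ 1) {v : H1 R}
    (h0 : ∀ i, inner ℝ (toL2 (lowMode R i)) (toL2 v) = 0) :
    11 / 10 * ‖toL2 v‖ ^ 2 ≤ ‖weakGrad v‖ ^ 2 := by
  have : highMode v = v := by simp [highMode, h0]
  have h := gap_highMode hR0 hR1 v
  rwa [this] at h

/-! ### The min-max values -/

theorem linearIndependent_lowMode (hR0 : 0 < R) (hR1 : R ≤ 1) :
    LinearIndependent ℝ (lowMode R) := by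
  rw [Fintype.linearIndependent_iff]
  intro c hc i
  have h := inner_toL2_lowMode_lowSum hR0 hR1 i c
  have h0 : toL2 (lowSum R c) = 0 := by rw [lowSum, hc]; rfl
  rw [h0, inner_zero_right] at h
  exact (mul_eq_zero.1 h.symm).resolve_right (inner_toL2_lowMode_self_pos hR0 hR1 i).ne'

/-- The span of `1, X₁, X₂` is a competitor of dimension three on which the Rayleigh quotient is at
most `1`. -/
theorem steklovEigenvalue_le_one (hR0 : 0 < R) (hR1 : R ≤ 1) {i : ℕ} (hi : i ≤ 2) :
    steklovEigenvalue R i ≤ 1 := by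
  refine iInf₂_le_of_le (Submodule.span ℝ (Set.range (lowMode R))) ?_ ?_
  · rw [rank_span (linearIndependent_lowMode hR0 hR1),
      Cardinal.mk_range_eq _ (linearIndependent_lowMode hR0 hR1).injective]
    simp only [Cardinal.mk_fintype, Fintype.card_fin]
    exact_mod_cast (by omega : i + 1 ≤ 3)
  · refine iSup_le fun v => iSup_le fun hv => iSup_le fun _ => ?_
    obtain ⟨c, rfl⟩ := (Submodule.mem_span_range_iff_exists_fun ℝ).1 hv
    refine ENNReal.div_le_of_le_mul ?_
    rw [one_mul]
    have h := norm_weakGrad_lowSum_le hR0 hR1 c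
    have h' : ‖weakGrad (lowSum R c)‖ ≤ ‖toL2 (lowSum R c)‖ :=
      le_of_sq_le_sq h (norm_nonneg _)
    gcongr
    rw [← ofReal_norm, ← ofReal_norm]
    exact ENNReal.ofReal_le_ofReal h'

/-- Otherwise the `n` functionals would embed `X` into `ℝⁿ`. The rank is a cardinal, so
infinite-dimensional `X` are included. -/
theorem exists_mem_ne_zero_of_lt_rank {V : Type*} [AddCommGroup V] [Module ℝ V]
    (X : Submodule ℝ V) {n : ℕ} (hX : ((n + 1 : ℕ) : Cardinal) ≤ Module.rank ℝ X)
    (f : Fin n → V →ₗ[ℝ] ℝ) : ∃ v ∈ X, v ≠ 0 ∧ ∀ i, f i v = 0 := by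
  by_contra! hcon
  have hinj : Function.Injective ((LinearMap.pi f).comp X.subtype) := by
    rw [← LinearMap.ker_eq_bot, LinearMap.ker_eq_bot']
    intro v hv
    by_contra hne
    obtain ⟨i, hi⟩ := hcon v v.2 fun h => hne (Subtype.ext h)
    exact hi (congrFun hv i)
  have h1 := LinearMap.lift_rank_le_of_injective _ hinj
  rw [rank_fun', Fintype.card_fin, Cardinal.lift_natCast] at h1
  have h2 : ((n + 1 : ℕ) : Cardinal) ≤ n := by
    have := (Cardinal.lift_le.2 hX).trans h1
    rwa [Cardinal.lift_natCast] at this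
  exact absurd (Nat.cast_le.1 h2) (by omega)

theorem ofReal_le_rayleigh {v : H1 R} (hv : v ≠ 0) {κ : ℝ} (hκ : 0 ≤ κ)
    (h : κ * ‖toL2 v‖ ^ 2 ≤ ‖weakGrad v‖ ^ 2) :
    ENNReal.ofReal κ ≤ ‖weakGrad v‖ₑ ^ 2 / ‖toL2 v‖ₑ ^ 2 := by
  by_cases h0 : toL2 v = 0
  -- Elements of `H1 R` are pairs, so a vanishing first component forces a nonzero gradient; the
  -- quotient is then `⊤`.
  · have h1 : weakGrad v ≠ 0 := fun h1 => hv (eq_zero_of_toL2_of_weakGrad h0 h1)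
    rw [h0, enorm_zero, zero_pow two_ne_zero, ENNReal.div_zero (by simpa using h1)]
    exact le_top
  · rw [ENNReal.le_div_iff_mul_le (.inl (by simpa using h0)) (.inl (by simp)),
      ← ofReal_norm, ← ofReal_norm, ← ENNReal.ofReal_pow (norm_nonneg _),
      ← ENNReal.ofReal_pow (norm_nonneg _), ← ENNReal.ofReal_mul hκ]
    exact ENNReal.ofReal_le_ofReal h

/-- The functional `v ↦ ⟨e, v⟩` on `H¹`, where `e` is one of `1, X₁, X₂`. -/
noncomputable def lowFunctional (R : ℝ) (i : Fin 3) : H1 R →ₗ[ℝ] ℝ :=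
  ((innerSL ℝ (toL2 (lowMode R i))).comp (toL2L R)).toLinearMap

theorem one_le_steklovEigenvalue (hR0 : 0 < R) (hR1 : R ≤ 1) {i : ℕ} (hi : 1 ≤ i) :
    1 ≤ steklovEigenvalue R i := by
  refine le_iInf₂ fun X hX => ?_
  obtain ⟨v, hvX, hv, h⟩ := exists_mem_ne_zero_of_lt_rank (n := 1) X
    (le_trans (by exact_mod_cast (by omega : 1 + 1 ≤ i + 1)) hX) fun _ => lowFunctional R 0
  refine le_iSup_of_le v (le_iSup_of_le hvX (le_iSup_of_le hv ?_))
  rw [← ENNReal.ofReal_one]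
  refine ofReal_le_rayleigh hv zero_le_one ?_
  rw [one_mul]
  exact poincare hR0 hR1 (h 0)

theorem one_lt_steklovEigenvalue (hR0 : 0 < R) (hR1 : R ≤ 1) {i : ℕ} (hi : 3 ≤ i) :
    1 < steklovEigenvalue R i := by
  have h1 : (1 : ℝ≥0∞) < ENNReal.ofReal (11 / 10) := by
    rw [← ENNReal.ofReal_one]
    exact (ENNReal.ofReal_lt_ofReal_iff (by norm_num)).2 (by norm_num)
  refine h1.trans_le (le_iInf₂ fun X hX => ?_)
  obtain ⟨v, hvX, hv, h⟩ := exists_mem_ne_zero_of_lt_rank (n := 3) X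
    (le_trans (by exact_mod_cast (by omega : 3 + 1 ≤ i + 1)) hX) (lowFunctional R)
  exact le_iSup_of_le v (le_iSup_of_le hvX (le_iSup_of_le hv
    (ofReal_le_rayleigh hv (by norm_num) (spectral_gap hR0 hR1 h))))

/-! ### Complete systems of eigenfunctions -/

theorem IsWeakSteklovEigenfunction.norm_weakGrad_sq {lam : ℝ} {φ : H1 R}
    (h : IsWeakSteklovEigenfunction R lam φ) : ‖weakGrad φ‖ ^ 2 = lam * ‖toL2 φ‖ ^ 2 := by
  rw [← real_inner_self_eq_norm_sq, ← real_inner_self_eq_norm_sq, h.weak]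

/-- Eigenfunctions with different eigenvalues are orthogonal: each weak equation is tested with the
other function. -/
theorem IsWeakSteklovEigenfunction.inner_lowMode {lam : ℝ} {φ : H1 R} (hR0 : 0 < R) (hR1 : R ≤ 1)
    (h : IsWeakSteklovEigenfunction R lam φ) {i : Fin 3} (hi : lam ≠ lowValue i) :
    inner ℝ (toL2 (lowMode R i)) (toL2 φ) = 0 := by
  have h1 := weak_lowMode hR0 hR1 i φ
  rw [real_inner_comm, h.weak, real_inner_comm] at h1
  have h2 : (lam - lowValue i) * inner ℝ (toL2 (lowMode R i)) (toL2 φ) = 0 := by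
    rw [sub_mul, h1, sub_self]
  exact (mul_eq_zero.1 h2).resolve_left (sub_ne_zero.2 hi)

theorem IsWeakSteklovEigenfunction.ge_of_ne {lam : ℝ} {φ : H1 R} (hR0 : 0 < R) (hR1 : R ≤ 1)
    (h : IsWeakSteklovEigenfunction R lam φ) (hn : ‖toL2 φ‖ = 1) (h0 : lam ≠ 0) (h1 : lam ≠ 1) :
    11 / 10 ≤ lam := by
  have := spectral_gap hR0 hR1 (v := φ) fun i => h.inner_lowMode hR0 hR1
    (by fin_cases i <;> simpa [lowValue])
  rw [h.norm_weakGrad_sq, hn] at this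
  linarith

/-- The total energy is zero, hence so is that of the high part, and the gap makes the high part
vanish. The coefficients of `X₁, X₂` vanish by orthogonality. -/
theorem IsWeakSteklovEigenfunction.toL2_mem_of_zero {φ : H1 R} (hR0 : 0 < R) (hR1 : R ≤ 1)
    (h : IsWeakSteklovEigenfunction R 0 φ) : ∃ c : ℝ, toL2 φ = c • toL2 (lowMode R 0) := by
  obtain ⟨c, hv, hc, -, h2⟩ := exists_eq_highMode_add_lowSum hR0 hR1 φ
  have h3 : ∀ i : Fin 3, i ≠ 0 → c i = 0 := fun i hi => coeff_eq_zero hR0 hR1 (hc i)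
    (h.inner_lowMode hR0 hR1 (by simp [lowValue_of_ne hi]))
  have h4 := gap_highMode hR0 hR1 φ
  have h5 := sq_nonneg ‖weakGrad (lowSum R c)‖
  rw [h.norm_weakGrad_sq, zero_mul] at h2
  have h6 : toL2 (highMode φ) = 0 := by
    have : ‖toL2 (highMode φ)‖ ^ 2 ≤ 0 := by linarith
    simpa using le_antisymm this (sq_nonneg _)
  refine ⟨c 0, ?_⟩
  rw [hv, toL2_add, h6, zero_add, toL2_lowSum, Finset.sum_eq_single 0]
  · intro i _ hi
    rw [h3 i hi, zero_smul]
  · simp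

/-- Orthogonality removes the constant. The low part then has energy equal to its squared norm, so
the high part must as well, which the factor `11/10` allows only if its `L²(μ̂)` norm is zero. -/
theorem IsWeakSteklovEigenfunction.toL2_mem_of_one {φ : H1 R} (hR0 : 0 < R) (hR1 : R ≤ 1)
    (h : IsWeakSteklovEigenfunction R 1 φ) :
    toL2 φ ∈ Submodule.span ℝ {toL2 (lowMode R 1), toL2 (lowMode R 2)} := by
  obtain ⟨c, hv, hc, h1, h2⟩ := exists_eq_highMode_add_lowSum hR0 hR1 φ
  have h3 : c 0 = 0 := coeff_eq_zero hR0 hR1 (hc 0)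
    (h.inner_lowMode hR0 hR1 (by simp [lowValue]))
  have h4 := gap_highMode hR0 hR1 φ
  rw [h.norm_weakGrad_sq, one_mul, h1, norm_weakGrad_lowSum_eq hR0 hR1 h3] at h2
  have h6 : toL2 (highMode φ) = 0 := by
    have : ‖toL2 (highMode φ)‖ ^ 2 ≤ 0 := by linarith
    simpa using le_antisymm this (sq_nonneg _)
  rw [hv, toL2_add, h6, zero_add, toL2_lowSum, Fin.sum_univ_three, h3, zero_smul, zero_add]
  exact Submodule.mem_span_pair.2 ⟨c 1, c 2, rfl⟩

theorem IsSteklovSystem.eq_zero {lam : ℕ → ℝ} {φ : ℕ → H1 R} (h : IsSteklovSystem R lam φ)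
    {w : L2hat R} (hw : ∀ i, inner ℝ w (toL2 (φ i)) = 0) : w = 0 := by
  have h1 := (Submodule.topologicalClosure_eq_top_iff).1 h.complete
  have h2 : w ∈ (Submodule.span ℝ (Set.range fun i => toL2 (φ i)))ᗮ := by
    rw [Submodule.mem_orthogonal']
    intro u hu
    induction hu using Submodule.span_induction with
    | mem x hx => obtain ⟨i, rfl⟩ := hx; exact hw i
    | zero => simp
    | add x y _ _ hx hy => rw [inner_add_right, hx, hy, add_zero]
    | smul a x _ hx => rw [inner_smul_right, hx, mul_zero]
  rw [h1] at h2
  simpa using h2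

theorem IsSteklovSystem.eigenvalues {lam : ℕ → ℝ} {φ : ℕ → H1 R} (hR0 : 0 < R) (hR1 : R ≤ 1)
    (h : IsSteklovSystem R lam φ) : lam 1 = 1 ∧ lam 2 = 1 ∧ ∀ i : ℕ, 3 ≤ i → 1 < lam i := by
  have hn : ∀ i, ‖toL2 (φ i)‖ = 1 := h.orthonormal.1
  have hge : ∀ i, lam i ≠ 0 → lam i ≠ 1 → 11 / 10 ≤ lam i := fun i =>
    (h.eigen i).ge_of_ne hR0 hR1 (hn i)
  have hnn : ∀ i, 0 ≤ lam i := fun i => by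
    have h1 := (h.eigen i).norm_weakGrad_sq
    rw [hn i] at h1
    nlinarith [sq_nonneg ‖weakGrad (φ i)‖]
  have hne : ∀ i, toL2 (lowMode R i) ≠ 0 := fun i h0 => by
    have := inner_toL2_lowMode_self_pos hR0 hR1 i
    rw [h0, inner_zero_left] at this
    exact lt_irrefl _ this
  have hzero : ∀ i, lam i = 0 → ∃ c : ℝ, toL2 (φ i) = c • toL2 (lowMode R 0) := fun i hi => by
    have := h.eigen i
    rw [hi] at this
    exact this.toL2_mem_of_zero hR0 hR1
  -- If every eigenvalue were positive, the constant function would be orthogonal to the complete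
  -- system.
  have h0 : lam 0 = 0 := by
    by_contra hcon
    refine hne 0 (h.eq_zero fun i => (h.eigen i).inner_lowMode hR0 hR1 ?_)
    have := h.mono (Nat.zero_le i)
    have h3 := lt_of_le_of_ne (hnn 0) (Ne.symm hcon)
    simp only [lowValue, Matrix.cons_val]
    linarith
  -- Two orthonormal functions cannot both be multiples of the constant.
  have h1 : lam 1 ≠ 0 := by
    intro h1
    obtain ⟨a, ha⟩ := hzero 0 h0
    obtain ⟨b, hb⟩ := hzero 1 h1
    have h01 : inner ℝ (toL2 (φ 0)) (toL2 (φ 1)) = 0 := h.orthonormal.2 (by norm_num)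
    have ha0 : a ≠ 0 := by
      rintro rfl
      have := hn 0
      rw [ha, zero_smul, norm_zero] at this
      exact zero_ne_one this
    have hb0 : b ≠ 0 := by
      rintro rfl
      have := hn 1
      rw [hb, zero_smul, norm_zero] at this
      exact zero_ne_one this
    rw [ha, hb, real_inner_smul_left, real_inner_smul_right] at h01
    exact mul_ne_zero ha0 (mul_ne_zero hb0 (inner_toL2_lowMode_self_pos hR0 hR1 0).ne') h01
  have hone : ∀ i, 1 ≤ i → 1 ≤ lam i := by
    intro i hi
    have h2 := lt_of_le_of_ne (hnn 1) (Ne.symm h1)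
    have h3 := h.mono hi
    by_cases h4 : lam i = 1
    · exact h4.ge
    · linarith [hge i (by linarith) h4]
  -- Otherwise only index `1` could carry the eigenvalue `1`. A nontrivial combination of `X₁, X₂`
  -- orthogonal to `φ 1` would then be orthogonal to the whole system.
  have h2 : lam 2 = 1 := by
    by_contra hcon
    have hbig : ∀ i, 2 ≤ i → 1 < lam i := fun i hi =>
      (lt_of_le_of_ne (hone 2 (by norm_num)) (Ne.symm hcon)).trans_le (h.mono hi)
    obtain ⟨c, hc0, hc, hc1⟩ : ∃ c : Fin 3 → ℝ, c 0 = 0 ∧ (c 1 ≠ 0 ∨ c 2 ≠ 0) ∧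
        inner ℝ (toL2 (lowSum R c)) (toL2 (φ 1)) = 0 := by
      simp_rw [inner_toL2_lowSum, Fin.sum_univ_three]
      by_cases he : inner ℝ (toL2 (lowMode R 1)) (toL2 (φ 1)) = 0
      · exact ⟨![0, 1, 0], by simp, by simp, by simp [he]⟩
      · exact ⟨![0, inner ℝ (toL2 (lowMode R 2)) (toL2 (φ 1)),
          -inner ℝ (toL2 (lowMode R 1)) (toL2 (φ 1))], by simp, by simp [he], by simp; ring⟩
    have hw : toL2 (lowSum R c) = 0 := by
      refine h.eq_zero fun i => ?_
      by_cases hi1 : i = 1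
      · rw [hi1, hc1]
      · have hlam : lam i ≠ 1 := by
          rcases Nat.lt_or_ge i 2 with hi | hi
          · have : i = 0 := by omega
            rw [this, h0]; norm_num
          · exact (hbig i hi).ne'
        have hv : ∀ j : Fin 3, j ≠ 0 → lam i ≠ lowValue j := fun j hj => by
          rwa [lowValue_of_ne hj]
        rw [inner_toL2_lowSum, Fin.sum_univ_three, hc0,
          (h.eigen i).inner_lowMode hR0 hR1 (hv 1 (by decide)),
          (h.eigen i).inner_lowMode hR0 hR1 (hv 2 (by decide))]
        simp
    have hcz : ∀ i, c i = 0 := fun i => by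
      have h3 := inner_toL2_lowMode_lowSum hR0 hR1 i c
      rw [hw, inner_zero_right] at h3
      exact (mul_eq_zero.1 h3.symm).resolve_right (inner_toL2_lowMode_self_pos hR0 hR1 i).ne'
    exact hc.elim (fun h => h (hcz 1)) fun h => h (hcz 2)
  have h1' : lam 1 = 1 := le_antisymm (h2 ▸ h.mono (by norm_num)) (hone 1 le_rfl)
  refine ⟨h1', h2, fun i hi => lt_of_le_of_ne (hone i (by omega)) fun hlam => ?_⟩
  have hmem : ∀ j, lam j = 1 →
      toL2 (φ j) ∈ Submodule.span ℝ {toL2 (lowMode R 1), toL2 (lowMode R 2)} := fun j hj => by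
    have := h.eigen j
    rw [hj] at this
    exact this.toL2_mem_of_one hR0 hR1
  -- If `lam i = 1`, the indices `1, 2, i` give three orthonormal vectors in a span of two.
  have hinj : Function.Injective ![1, 2, i] := by
    intro a b hab
    fin_cases a <;> fin_cases b <;> simp at hab ⊢ <;> omega
  have hLI := (h.orthonormal.comp _ hinj).linearIndependent
  have hle : Submodule.span ℝ (Set.range ((fun i => toL2 (φ i)) ∘ ![1, 2, i])) ≤
      Submodule.span ℝ {toL2 (lowMode R 1), toL2 (lowMode R 2)} := by
    rw [Submodule.span_le]
    rintro _ ⟨j, rfl⟩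
    refine hmem _ ?_
    fin_cases j
    · exact h1'
    · exact h2
    · exact hlam.symm
  have hfin : (Submodule.span ℝ {toL2 (lowMode R 1), toL2 (lowMode R 2)}).FG :=
    Submodule.fg_span (by simp)
  have := Module.Finite.iff_fg.2 hfin
  have h3 := Submodule.finrank_mono hle
  rw [finrank_span_eq_card hLI, Fintype.card_fin] at h3
  classical
  have h4 := finrank_span_finset_le_card (R := ℝ)
    ({toL2 (lowMode R 1), toL2 (lowMode R 2)} : Finset (L2hat R))
  have h5 := Finset.card_le_two (a := toL2 (lowMode R 1)) (b := toL2 (lowMode R 2))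
  rw [Finset.coe_pair, Set.finrank] at h4
  omega

end Spectrum

/-! ### The coordinate functions are classical eigenfunctions -/

theorem hasDerivAt_norm_inv_line {y : E3} (hy : y ≠ 0) (v : E3) :
    HasDerivAt (fun t : ℝ => ‖y + t • v‖⁻¹) (-(inner ℝ y v * ‖y‖⁻¹ ^ 3)) 0 := by
  have hn : 0 < ‖y‖ := norm_pos_iff.2 hy
  have e : ∀ t : ℝ, ‖y + t • v‖ = √(‖y‖ ^ 2 + 2 * inner ℝ y v * t + ‖v‖ ^ 2 * t ^ 2) := fun t => by
    rw [← Real.sqrt_sq (norm_nonneg (y + t • v)), norm_add_sq_real, inner_smul_right, norm_smul,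
      mul_pow, Real.norm_eq_abs, sq_abs]
    congr 1; ring
  simp_rw [e]
  have h1 : HasDerivAt (fun t : ℝ => ‖y‖ ^ 2 + 2 * inner ℝ y v * t + ‖v‖ ^ 2 * t ^ 2)
      (2 * inner ℝ y v) 0 :=
    ((((hasDerivAt_id (0 : ℝ)).const_mul (2 * inner ℝ y v)).const_add (‖y‖ ^ 2)).add
      ((hasDerivAt_pow 2 (0 : ℝ)).const_mul (‖v‖ ^ 2))).congr_deriv (by simp)
  have h2 := (h1.sqrt (by simpa using hn.ne')).inv (by
    simpa [Real.sqrt_sq hn.le] using hn.ne')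
  refine h2.congr_deriv ?_
  simp only [mul_zero, add_zero, zero_pow two_ne_zero, Real.sqrt_sq hn.le]
  field_simp

theorem hasDerivAt_coord_line (i : Fin 3) (y v : E3) :
    HasDerivAt (fun t : ℝ => (y + t • v) i) (v i) 0 := by
  simpa using! ((hasDerivAt_id (0 : ℝ)).mul_const (v i)).const_add (y i)

theorem hasDerivAt_inner_line (y v : E3) :
    HasDerivAt (fun t : ℝ => (inner ℝ (y + t • v) v : ℝ)) (‖v‖ ^ 2) 0 := by
  have e : ∀ t : ℝ, (inner ℝ (y + t • v) v : ℝ) = inner ℝ y v + t * ‖v‖ ^ 2 := fun t => by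
    rw [inner_add_left, real_inner_smul_left, real_inner_self_eq_norm_sq]
  simp_rw [e]
  simpa using! ((hasDerivAt_id (0 : ℝ)).mul_const (‖v‖ ^ 2)).const_add (inner ℝ y v)

theorem contDiffAt_radial_coord (i : Fin 3) {y : E3} (hy : y ≠ 0) :
    ContDiffAt ℝ 2 (fun y : E3 => ‖y‖⁻¹ * y i) y :=
  ((contDiffAt_norm ℝ hy).inv (norm_ne_zero_iff.2 hy)).mul
    (by fun_prop : ContDiff ℝ 2 fun y : E3 => y i).contDiffAt

theorem fderiv_radial_coord (i : Fin 3) {y : E3} (hy : y ≠ 0) (v : E3) :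
    fderiv ℝ (fun y : E3 => ‖y‖⁻¹ * y i) y v
      = ‖y‖⁻¹ * v i - y i * inner ℝ y v * ‖y‖⁻¹ ^ 3 := by
  rw [← ((contDiffAt_radial_coord i hy).differentiableAt two_ne_zero).lineDeriv_eq_fderiv, lineDeriv]
  have h := (hasDerivAt_norm_inv_line hy v).mul (hasDerivAt_coord_line i y v)
  refine (h.deriv.trans ?_)
  simp; ring

/-- The first derivative is known explicitly away from the origin, hence near `x`; the second is
then found by differentiating that formula along the line `x + t v`. -/
theorem fderiv_fderiv_radial_coord (i : Fin 3) {x : E3} (hx : ‖x‖ = 1) (v : E3) :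
    fderiv ℝ (fderiv ℝ (fun y : E3 => ‖y‖⁻¹ * y i)) x v v
      = -2 * v i * inner ℝ x v - x i * ‖v‖ ^ 2 + 3 * x i * inner ℝ x v ^ 2 := by
  have hx0 : x ≠ 0 := by rintro rfl; simp at hx
  have hd : DifferentiableAt ℝ (fderiv ℝ (fun y : E3 => ‖y‖⁻¹ * y i)) x :=
    ((contDiffAt_radial_coord i hx0).fderiv_right (m := 1) (by norm_num)).differentiableAt
      one_ne_zero
  set K : E3 → ℝ := fun y => ‖y‖⁻¹ * v i - y i * inner ℝ y v * ‖y‖⁻¹ ^ 3 with hK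
  have heq : (fun y => fderiv ℝ (fun y : E3 => ‖y‖⁻¹ * y i) y v) =ᶠ[nhds x] K := by
    filter_upwards [isOpen_ne.mem_nhds hx0] with y hy
    exact fderiv_radial_coord i hy v
  have hd' : DifferentiableAt ℝ (fun y => fderiv ℝ (fun y : E3 => ‖y‖⁻¹ * y i) y v) x :=
    hd.clm_apply (differentiableAt_const v)
  have h1 : fderiv ℝ (fderiv ℝ (fun y : E3 => ‖y‖⁻¹ * y i)) x v v
      = fderiv ℝ (fun y => fderiv ℝ (fun y : E3 => ‖y‖⁻¹ * y i) y v) x v := by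
    rw [fderiv_clm_apply hd (differentiableAt_const v)]
    simp
  have hdK : DifferentiableAt ℝ K x := heq.differentiableAt_iff.1 hd'
  rw [h1, heq.fderiv_eq, ← hdK.lineDeriv_eq_fderiv, lineDeriv]
  have h2 := hasDerivAt_norm_inv_line hx0 v
  have h := (h2.mul_const (v i)).sub
    (((hasDerivAt_coord_line i x v).mul (hasDerivAt_inner_line x v)).mul (h2.pow 3))
  refine h.deriv.trans ?_
  simp [hx]; ring

theorem sphereLaplacian_coord (i : Fin 3) {x : E3} (hx : ‖x‖ = 1) :
    sphereLaplacian (coord i) x = -2 * x i := by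
  have e : (fun y : E3 => coord i (‖y‖⁻¹ • y)) = fun y => ‖y‖⁻¹ * y i := by
    funext y; simp [coord]
  rw [sphereLaplacian, e, InnerProductSpace.laplacian_eq_iteratedFDeriv_orthonormalBasis _
    (EuclideanSpace.basisFun (Fin 3) ℝ)]
  simp only [iteratedFDeriv_two_apply, Matrix.cons_val, fderiv_fderiv_radial_coord i hx]
  have h2 : x 0 ^ 2 + x 1 ^ 2 + x 2 ^ 2 = 1 := by rw [← norm_sq_E3, hx]; norm_num
  have hin : ∀ j, inner ℝ x (EuclideanSpace.basisFun (Fin 3) ℝ j) = x j := fun j => by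
    rw [EuclideanSpace.basisFun_apply, EuclideanSpace.inner_single_right]; simp
  have hnv : ∀ j, ‖EuclideanSpace.basisFun (Fin 3) ℝ j‖ = 1 := fun j =>
    (EuclideanSpace.basisFun (Fin 3) ℝ).orthonormal.1 j
  simp only [hin, hnv]
  simp only [EuclideanSpace.basisFun_apply, Fin.sum_univ_three]
  -- Summed over the basis, the three terms give `-2 xᵢ`, `-3 xᵢ` and `3 xᵢ |x|² = 3 xᵢ`.
  fin_cases i <;> simp <;> linear_combination (3 * x _) * h2

/-- The normal is perpendicular to `x`, so the tangential projection in `sphereGrad` has no effect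
and the product is the `i`-th coordinate of the normal, `σ xᵢ / r`, with `σ / r = k_R`. -/
theorem inner_sphereGrad_coord_outerNormal {R : ℝ} (hR0 : 0 < R) {i : Fin 3} (hi : i = 0 ∨ i = 1)
    {x : E3} (hx : x ∈ capBoundary R) :
    inner ℝ (sphereGrad (coord i) x) (outerNormal R x) = boundaryCurvature R * x i := by
  have hr := capRadius_pos hR0
  obtain ⟨z, hz, rfl⟩ := hx
  have hz1 : ‖z‖ = 1 := by simpa using hz
  set x := stereoInv (R • z) with hxdef
  have hx1 : ‖x‖ = 1 := norm_stereoInv _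
  have hx2 : x 2 = capHeight R := by
    rw [hxdef, stereoInv_apply_two, norm_smul, hz1, mul_one, Real.norm_eq_abs, sq_abs, capHeight]
  have hsq : x 0 ^ 2 + x 1 ^ 2 = capRadius R ^ 2 := by
    have h1 := norm_sq_E3 x
    rw [hx1, hx2] at h1
    linarith [capHeight_sq_add_capRadius_sq R]
  have hperp : inner ℝ x (outerNormal R x) = 0 := by
    simp only [PiLp.inner_apply, Fin.sum_univ_three, outerNormal, Matrix.cons_val,
      RCLike.inner_apply, conj_trivial, hx2]
    field_simp
    linear_combination (capHeight R) * hsq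
  have hg : ∀ v, inner ℝ (gradient (coord i) x) v = v i := fun v => by
    simp [gradient, fderiv_coord]
  rw [sphereGrad, inner_sub_left, real_inner_smul_left, hperp, mul_zero, sub_zero, hg]
  have hk : boundaryCurvature R = capHeight R / capRadius R := by
    rw [← boundaryCurvature_mul_capRadius hR0]; field_simp
  rcases hi with rfl | rfl <;> simp only [outerNormal, Matrix.cons_val, hk] <;> ring

theorem isSteklovEigenfunction_coord {R : ℝ} (hR0 : 0 < R) {i : Fin 3} (hi : i = 0 ∨ i = 1) :
    IsSteklovEigenfunction R 1 (coord i) where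
  smooth := contDiff_coord i
  nontrivial := by
    -- A single point of the disc serves both coordinates: its squared norm is `1/2`, and `X₁, X₂`
    -- are both positive at its image.
    refine ⟨_, ⟨!₂[1 / 2, 1 / 2], ?_, rfl⟩, ?_⟩
    · rw [mem_ball_zero_iff]
      refine lt_of_pow_lt_pow_left₀ 2 zero_le_one ?_
      rw [norm_sq_E2]; norm_num
    · have hp : ∀ y : E2, 0 < 1 + ‖y‖ ^ 2 := fun y => by positivity
      rcases hi with rfl | rfl <;>
      · simp only [coord, stereoInv, Matrix.cons_val]
        refine (div_pos ?_ (hp _)).ne'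
        simpa using hR0
  interior x hx := by
    rw [sphereLaplacian_coord i ((mem_cap_iff hR0).1 hx).1, coord]; ring
  boundary x hx := by
    rw [inner_sphereGrad_coord_outerNormal hR0 hi hx, coord, one_mul]

theorem isWeakSteklovEigenfunction_coord {R : ℝ} (hR0 : 0 < R) (hR1 : R ≤ 1) {i : Fin 3}
    (hi : i = 0 ∨ i = 1) :
    IsWeakSteklovEigenfunction R 1 (ofSmooth R (coord i) (contDiff_coord i)) := by
  have key : ∀ j : Fin 3, j ≠ 0 → IsWeakSteklovEigenfunction R 1 (lowMode R j) := fun j hj =>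
    { nontrivial := (linearIndependent_lowMode hR0 hR1).ne_zero j
      weak := fun ψ => by rw [weak_lowMode hR0 hR1, lowValue_of_ne hj] }
  rcases hi with rfl | rfl
  · exact key 1 (by decide)
  · exact key 2 (by decide)

end SteklovCap

theorem lemma5p2 (R : ℝ) (hR0 : 0 < R) (hR1 : R ≤ 1) :
    (∀ i : Fin 3, i = 0 ∨ i = 1 →
      SteklovCap.IsSteklovEigenfunction R 1 (SteklovCap.coord i) ∧
      SteklovCap.IsWeakSteklovEigenfunction R 1
        (SteklovCap.ofSmooth R (SteklovCap.coord i) (SteklovCap.contDiff_coord i))) ∧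
    (SteklovCap.steklovEigenvalue R 1 = 1 ∧ SteklovCap.steklovEigenvalue R 2 = 1 ∧
      ∀ i : ℕ, 3 ≤ i → 1 < SteklovCap.steklovEigenvalue R i) ∧
    (∀ (lam : ℕ → ℝ) (φ : ℕ → SteklovCap.H1 R), SteklovCap.IsSteklovSystem R lam φ →
      lam 1 = 1 ∧ lam 2 = 1 ∧ ∀ i : ℕ, 3 ≤ i → 1 < lam i) := by
  refine ⟨fun i hi => ⟨SteklovCap.isSteklovEigenfunction_coord hR0 hi,
    SteklovCap.isWeakSteklovEigenfunction_coord hR0 hR1 hi⟩, ⟨?_, ?_, fun i hi => ?_⟩,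
    fun lam φ h => h.eigenvalues hR0 hR1⟩
  · exact le_antisymm (SteklovCap.steklovEigenvalue_le_one hR0 hR1 (by norm_num))
      (SteklovCap.one_le_steklovEigenvalue hR0 hR1 le_rfl)
  · exact le_antisymm (SteklovCap.steklovEigenvalue_le_one hR0 hR1 le_rfl)
      (SteklovCap.one_le_steklovEigenvalue hR0 hR1 (by norm_num))
  · exact SteklovCap.one_lt_steklovEigenvalue hR0 hR1 hi
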